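/- All topological spaces and (real) topological vector spaces are assumed Hausdorff. Let $M$ be a topological space and let $(M_\alpha)_{\alpha\in A}$ be a family of subsets of $M$, indexed by a (non-empty) directed set $A$, with $M_\alpha\subseteq M_\beta$ for $\alpha\le\beta$. Let each $M_\alpha$ be equipped with a topology (not necessarily the subspace topology) such that all inclusion maps $M_\alpha\to M$ and $M_\alpha\to M_\beta$ ($\alpha\le\beta$) are continuous, and assume that $M_\infty:=\bigcup_{\alpha\in A}M_\alpha$ is dense in $M$. For a subset $Y$ of a real vector space, let $\operatorname{conv}_2(Y):=\{ty_1+(1-t)y_2: y_1,y_2\in Y,\ t\in[0,1]\}$. A *well-filled chart* of $M$ is a homeomorphism $\phi\colon U\to V$ from an open subset $U\subseteq M$ onto a (not necessarily open) subset $V$ of a topological vector space $E$ for which there exist $\alpha_0\in A$, homeomorphisms $\phi_\alpha\colon U_\alpha\to V_\alpha$ from open subsets $U_\alpha\subseteq M_\alpha$ onto subsets $V_\alpha$ of topological vector spaces $E_\alpha$ (for $\alpha\ge\alpha_0$), and continuous linear maps $\lambda_\alpha\colon E_\alpha\to E$ and $\lambda_{\beta,\alpha}\colon E_\alpha\to E_\beta$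 (for $\beta\ge\alpha\ge\alpha_0$), such that: * (a) $U_\alpha\subseteq U$ and $\phi|_{U_\alpha}=\lambda_\alpha\circ\phi_\alpha$ for all $\alpha\ge\alpha_0$; * (b) $U_\alpha\subseteq U_\beta$ and $\phi_\beta|_{U_\alpha}=\lambda_{\beta,\alpha}\circ\phi_\alpha$ for all $\beta\ge\alpha\ge\alpha_0$; * (d) $\bigcup_{\alpha\ge\alpha_0}U_\alpha=U\cap M_\infty$; * (e) there is a non-empty relatively open subset $V^{(2)}\subseteq V$ such that $\operatorname{conv}_2(V^{(2)})\subseteq V$ and $\operatorname{conv}_2(V^{(2)}\cap V_\infty)\subseteq V_\infty$, where $V_\infty:=\bigcup_{\alpha\ge\alpha_0}\lambda_\alpha(V_\alpha)$; * (f) for each $\alpha\ge\alpha_0$ and each compact set $K\subseteq V_\alpha$ with $\lambda_\alpha(K)\subseteq V^{(2)}$, there exists $\beta\ge\alpha$ such that $\operatorname{conv}_2(\lambda_{\beta,\alpha}(K))\subseteq V_\beta$. (One usually regards each $E_\alpha$ as a vector subspace of $E$ with a possibly finer vector topology; then $\lambda_\alpha$ and $\lambda_{\beta,\alpha}$ are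 the inclusion maps.) For any such choice, the set $U^{(2)}:=\phi^{-1}(V^{(2)})$ is called a *core* of $\phi$. Assume that $M$ *admits well-filled charts*, that is, $M$ is covered by cores of well-filled charts. Let $\mathcal O$ be a topology on $M_\infty$ such that 1. all inclusion maps $\sigma_\alpha\colon M_\alpha\to(M_\infty,\mathcal O)$ ($\alpha\in A$) and the inclusion map $\sigma\colon(M_\infty,\mathcal O)\to M$ are continuous; and 2. $(M_\infty,\mathcal O)=\bigcup_{\alpha\in A}M_\alpha$ is *compactly retractive*: each compact subset $K$ of $(M_\infty,\mathcal O)$ is contained in some $M_\alpha$ such that $M_\alpha$ and $(M_\infty,\mathcal O)$ induce the same topology on $K$. Then $\sigma\colon(M_\infty,\mathcal O)\to M$ is a weak homotopy equivalence: $\sigma$ induces a bijection between the sets of path components, and $\sigma_*\colon\pi_k(M_\infty,p)\to\pi_k(M,p)$ is a bijection for all $k\in\mathbb N_0$ and all $p\in M_\infty$ (hence a group isomorphism for $k\ge1$). -/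

import Mathlib

open Topology Set

/-! ### Weak homotopy equivalences -/

/-- The map `Ω^N(X, x) → Ω^N(Y, f x)`, `γ ↦ f ∘ γ`. -/
def genLoopPush (N : Type*) {X Y : Type*} [TopologicalSpace X] [TopologicalSpace Y]
    (f : C(X, Y)) (x : X) (g : GenLoop N X x) : GenLoop N Y (f x) :=
  ⟨f.comp g.1, fun y hy => congrArg f (g.2 y hy)⟩

/-- The map `f_* : π_n(X, x) → π_n(Y, f x)`, `[γ] ↦ [f ∘ γ]`. -/
def piMap (n : ℕ) {X Y : Type*} [TopologicalSpace X] [TopologicalSpace Y]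
    (f : C(X, Y)) (x : X) : HomotopyGroup.Pi n X x → HomotopyGroup.Pi n Y (f x) :=
  Quotient.map (genLoopPush (Fin n) f x) (fun _ _ h => h.map fun H => H.compContinuousMap f)

/-- The map induced by `f` on the sets of path components, `[x] ↦ [f x]`. -/
def piZeroMap {X Y : Type*} [TopologicalSpace X] [TopologicalSpace Y]
    (f : C(X, Y)) : ZerothHomotopy X → ZerothHomotopy Y :=
  Quotient.map f (fun _ _ h => h.map f.continuous)

/-- `f` is a weak homotopy equivalence: it induces a bijection between the sets of path components
and bijections `π_n(X, x) → π_n(Y, f x)` for all `n ∈ ℕ₀` and all base points `x`. (The first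
condition follows from the second with `n = 0` unless `X` is empty.) -/
def IsWeakHomotopyEquivalence {X Y : Type*} [TopologicalSpace X] [TopologicalSpace Y]
    (f : C(X, Y)) : Prop :=
  Function.Bijective (piZeroMap f) ∧
    ∀ (n : ℕ) (x : X), Function.Bijective (piMap n f x)

/-! ### Directed families of subsets, each with a topology of its own -/

/-- The set `M_α` as a type. This is deliberately not the coercion of `S α`, so that it does *not*
inherit the subspace topology of `M`: its topology is a separate datum. -/
def Step {M A : Type*} [Preorder A] (S : A →o Set M) (α : A) : Type _ := {x : M // x ∈ S α}

/-- A point of `M_α` as a term of `Step S α`. -/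
def Step.mk {M A : Type*} [Preorder A] (S : A →o Set M) {α : A} (x : M) (hx : x ∈ S α) :
    Step S α := ⟨x, hx⟩

/-- The set `M_∞ = ⋃ α, M_α` as a type, again without a topology. -/
def UnionSpace {M A : Type*} [Preorder A] (S : A →o Set M) : Type _ := {x : M // x ∈ ⋃ α, S α}

section Inclusions

variable {M A : Type*} [Preorder A] (S : A →o Set M)

/-- The inclusion `M_α → M`. -/
def stepIncl (α : A) : Step S α → M := Subtype.val

/-- The inclusion `M_α → M_β` for `α ≤ β`. -/
def stepTrans {α β : A} (h : α ≤ β) : Step S α → Step S β := fun x => ⟨x.1, S.monotone h x.2⟩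

/-- The inclusion `M_α → M_∞`. -/
def stepToUnion (α : A) : Step S α → UnionSpace S := fun x => ⟨x.1, mem_iUnion_of_mem α x.2⟩

/-- The inclusion `M_∞ → M`. -/
def unionIncl : UnionSpace S → M := Subtype.val

end Inclusions

/-- `M_∞ = ⋃ α, M_α` (with the given topologies) is compactly retractive: each compact subset `K` of
`M_∞` is contained in some `M_α` which induces the same topology on `K` as `M_∞`. -/
def CompactlyRetractive {M A : Type*} [Preorder A] (S : A →o Set M)
    [∀ α, TopologicalSpace (Step S α)] [TopologicalSpace (UnionSpace S)] : Prop :=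
  ∀ K : Set (UnionSpace S), IsCompact K →
    ∃ (α : A) (hK : ∀ x ∈ K, unionIncl S x ∈ S α),
      TopologicalSpace.induced
          (fun x : K => Step.mk S (unionIncl S x.1) (hK x.1 x.2)) inferInstance =
        TopologicalSpace.induced (Subtype.val : K → UnionSpace S) inferInstance

/-! ### Well-filled charts -/

/-- The set `conv₂(Y)` of all `t y₁ + (1 - t) y₂` with `y₁, y₂ ∈ Y` and `t ∈ [0,1]`. -/
def convTwo {E : Type*} [AddCommGroup E] [Module ℝ E] (Y : Set E) : Set E :=
  {z | ∃ y₁ ∈ Y, ∃ y₂ ∈ Y, ∃ t ∈ Icc (0 : ℝ) 1, z = t • y₁ + (1 - t) • y₂}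

/-- A well-filled chart `φ : U → V ⊆ E` of `M`, together with the spaces, maps and sets which
witness that it is well-filled. The maps `φ` and `φ_α` are given as functions on all of `M` and
`M_α`, of which only the restrictions to `U` and `U_α` matter. Only the `E_α`, `U_α`, `φ_α`, `λ_α`
and `λ_{β,α}` with `β ≥ α ≥ α₀` matter.

If each `λ_α` is injective and `E_α` is regarded as a vector subspace of `E` (with a finer vector
topology), then `λ_α` and `λ_{β,α}` below are the inclusion maps. No injectivity is needed, as
the convex combinations of `(f)` are formed in `E_β`. -/
structure WellFilledChart {M A : Type*} [TopologicalSpace M] [Preorder A] (S : A →o Set M)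
    [∀ α, TopologicalSpace (Step S α)]
    (E : Type*) [AddCommGroup E] [Module ℝ E] [TopologicalSpace E]
    (Eα : A → Type*) [∀ α, AddCommGroup (Eα α)] [∀ α, Module ℝ (Eα α)]
    [∀ α, TopologicalSpace (Eα α)] where
  /-- The domain of the chart. -/
  U : Set M
  isOpen_U : IsOpen U
  /-- The chart, a homeomorphism from `U` onto the subset `V = φ(U)` of `E`. -/
  φ : M → E
  isEmbedding_φ : IsEmbedding (U.domRestrict φ)
  /-- The index from which on the steps are charted. -/
  α₀ : A
  /-- The domains of the charts of the steps. -/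
  Uα : ∀ α, Set (Step S α)
  isOpen_Uα : ∀ α, α₀ ≤ α → IsOpen (Uα α)
  /-- The charts of the steps, homeomorphisms from `U_α` onto subsets `V_α = φ_α(U_α)` of `E_α`. -/
  φα : ∀ α, Step S α → Eα α
  isEmbedding_φα : ∀ α, α₀ ≤ α → IsEmbedding ((Uα α).domRestrict (φα α))
  /-- The continuous linear maps `λ_α : E_α → E`. -/
  lam : ∀ α, Eα α →L[ℝ] E
  /-- The continuous linear maps `λ_{β,α} : E_α → E_β`. -/
  lamTrans : ∀ α β, Eα α →L[ℝ] Eα β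
  /-- (a): `U_α ⊆ U`, and `φ = λ_α ∘ φ_α` on `U_α`. -/
  cond_a : ∀ α, α₀ ≤ α → ∀ x ∈ Uα α, stepIncl S α x ∈ U ∧ φ (stepIncl S α x) = lam α (φα α x)
  /-- (b): `U_α ⊆ U_β`, and `φ_β = λ_{β,α} ∘ φ_α` on `U_α`. -/
  cond_b : ∀ α β, α₀ ≤ α → ∀ h : α ≤ β, ∀ x ∈ Uα α,
    stepTrans S h x ∈ Uα β ∧ φα β (stepTrans S h x) = lamTrans α β (φα α x)
  /-- (d): the union of all `U_α` is `U ∩ M_∞`. -/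
  cond_d : (⋃ α ∈ Ici α₀, stepIncl S α '' Uα α) = U ∩ ⋃ α, S α
  /-- The set `V⁽²⁾`. -/
  V2 : Set E
  V2_nonempty : V2.Nonempty
  /-- `V⁽²⁾` is a relatively open subset of `V`. -/
  V2_relOpen : ∃ W : Set E, IsOpen W ∧ V2 = W ∩ φ '' U
  /-- (e), first part: `conv₂(V⁽²⁾) ⊆ V`. -/
  cond_e : convTwo V2 ⊆ φ '' U
  /-- (e), second part: `conv₂(V⁽²⁾ ∩ V_∞) ⊆ V_∞`, where `V_∞` is the union of all `V_α`. -/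
  cond_e_infty : convTwo (V2 ∩ ⋃ α ∈ Ici α₀, lam α '' (φα α '' Uα α)) ⊆
    ⋃ α ∈ Ici α₀, lam α '' (φα α '' Uα α)
  /-- (f): for each compact subset `K` of `V_α ∩ V⁽²⁾` there is `β ≥ α` with `conv₂(K) ⊆ V_β`. -/
  cond_f : ∀ α, α₀ ≤ α → ∀ K : Set (Eα α), IsCompact K → K ⊆ φα α '' Uα α → lam α '' K ⊆ V2 →
    ∃ β, α ≤ β ∧ convTwo (lamTrans α β '' K) ⊆ φα β '' Uα β

/-- The core `U⁽²⁾ = φ⁻¹(V⁽²⁾)` of a well-filled chart. -/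
def WellFilledChart.core {M A : Type*} [TopologicalSpace M] [Preorder A] {S : A →o Set M}
    [∀ α, TopologicalSpace (Step S α)]
    {E : Type*} [AddCommGroup E] [Module ℝ E] [TopologicalSpace E]
    {Eα : A → Type*} [∀ α, AddCommGroup (Eα α)] [∀ α, Module ℝ (Eα α)]
    [∀ α, TopologicalSpace (Eα α)] (c : WellFilledChart S E Eα) : Set M :=
  {x ∈ c.U | c.φ x ∈ c.V2}

universe u v w w'

/-- `M` admits well-filled charts: each point of `M` lies in a core of a well-filled chart with values
in a Hausdorff real topological vector space `E` (and with Hausdorff real topological vector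
spaces `E_α`). -/
def AdmitsWellFilledCharts {M : Type u} {A : Type v} [TopologicalSpace M] [Preorder A]
    (S : A →o Set M) [∀ α, TopologicalSpace (Step S α)] : Prop :=
  ∀ q : M, ∃ (E : Type w) (_ : AddCommGroup E) (_ : Module ℝ E) (_ : TopologicalSpace E)
    (_ : IsTopologicalAddGroup E) (_ : ContinuousSMul ℝ E) (_ : T2Space E)
    (Eα : A → Type w') (_ : ∀ α, AddCommGroup (Eα α)) (_ : ∀ α, Module ℝ (Eα α))
    (_ : ∀ α, TopologicalSpace (Eα α)) (_ : ∀ α, IsTopologicalAddGroup (Eα α))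
    (_ : ∀ α, ContinuousSMul ℝ (Eα α)) (_ : ∀ α, T2Space (Eα α))
    (c : WellFilledChart S E Eα), q ∈ c.core

/-! The map `σ` is a weak equivalence because small spheres can be filled, compatibly, in both
spaces. Every neighbourhood `N` of a point of `M` contains a smaller one `W` such that maps of
sphere boundaries into `W` extend over the ball inside `N`, and maps into `σ ⁻¹' W` extend inside `σ
⁻¹' N` (`exists_coneExtends_nhd`).

In `M` one cones in the chart: (e) keeps the cone in `V`, and the tube lemma keeps it small without
any local convexity. In `M_∞` the sphere together with the apex is compact, so compact retractivity
puts it in one step; by (f) the cone, formed in a later `E_β`, stays in `V_β` and is therefore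
continuous into that step, hence into `M_∞`. Density supplies an apex in `M_∞`.

The rest uses only this filling property. By `exists_cube_extension`, a map of a cube to `M` that is
lifted on `Z ∩ T` can be altered off `Z` so as to be lifted on all of `T`. The new map is built on a
fine cubical grid, cell by cell in increasing dimension: cells in `T` are filled in `P` and pushed
down by `σ`, all others are filled in `M`. Neighbourhoods of the graph of the old map keep each cell
boundary small enough to fill. Suitable facets as `Z` and `T` give surjectivity and injectivity on
homotopy groups. -/

/-! ### Cells and cones -/

/-- The box with centre `c`, half-width `h` in the directions of `J` and width `0` in the others. -/
def boxCell {ι : Type} [Fintype ι] (c : ι → ℝ) (h : ℝ) (J : Set ι) : Set (ι → ℝ) :=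
  {y | ‖y - c‖ ≤ h ∧ ∀ i ∉ J, y i = c i}

/-- The relative boundary of `boxCell c h J`. -/
def boxBdry {ι : Type} [Fintype ι] (c : ι → ℝ) (h : ℝ) (J : Set ι) : Set (ι → ℝ) :=
  {y | ‖y - c‖ = h ∧ ∀ i ∉ J, y i = c i}

theorem isClosed_eq_off {ι : Type*} (c : ι → ℝ) (J : Set ι) :
    IsClosed {y : ι → ℝ | ∀ i ∉ J, y i = c i} := by
  simp only [ofPred_forall]
  exact isClosed_iInter fun i => isClosed_iInter fun _ =>
    isClosed_eq (continuous_apply i) continuous_const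

section Box

variable {ι : Type} [Fintype ι] (c : ι → ℝ) (h : ℝ) (J : Set ι)

theorem boxBdry_subset : boxBdry c h J ⊆ boxCell c h J := fun _ hy => ⟨hy.1.le, hy.2⟩

theorem isCompact_boxCell : IsCompact (boxCell c h J) := by
  have : boxCell c h J = Metric.closedBall c h ∩ {y : ι → ℝ | ∀ i ∉ J, y i = c i} := by
    ext y; simp [boxCell, dist_eq_norm]
  rw [this]
  exact (isCompact_closedBall c h).inter_right (isClosed_eq_off c J)

theorem isCompact_boxBdry : IsCompact (boxBdry c h J) := by
  have : boxBdry c h J = Metric.sphere c h ∩ {y : ι → ℝ | ∀ i ∉ J, y i = c i} := by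
    ext y; simp [boxBdry]
  rw [this]
  exact (isCompact_sphere c h).inter_right (isClosed_eq_off c J)

/-- A map from the boundary of a box to a topological vector space extends to the cone over it with
a given apex. -/
theorem exists_cone_extension {E : Type*} [AddCommGroup E] [Module ℝ E] [TopologicalSpace E]
    [IsTopologicalAddGroup E] [ContinuousSMul ℝ E] (hh : 0 < h) (k : (ι → ℝ) → E)
    (hk : ContinuousOn k (boxBdry c h J)) (v : E) :
    ∃ Γ : boxCell c h J → E, Continuous Γ ∧ (∀ y : boxCell c h J, y.1 ∈ boxBdry c h J → Γ y = k y) ∧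
      ∀ y, Γ y ∈ convTwo (insert v (k '' boxBdry c h J)) := by
  have hnorm : ∀ (t : Icc (0 : ℝ) 1) (b : boxBdry c h J), ‖t.1 • (b.1 - c)‖ = t.1 * h := by
    intro t b
    rw [norm_smul, b.2.1, Real.norm_of_nonneg t.2.1]
  -- Continuity of the cone at its apex is awkward for a general `E`, so it is tested on the
  -- cylinder over the boundary, of which the box is a quotient by compactness. The `Unit` summand
  -- covers the centre when `J` is empty: the boundary is then empty too.
  let q : (Icc (0 : ℝ) 1 × boxBdry c h J) ⊕ Unit → boxCell c h J :=
    Sum.elim (fun p => ⟨c + p.1.1 • (p.2.1 - c), by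
        refine ⟨?_, fun i hi => ?_⟩
        · rw [add_sub_cancel_left, hnorm]
          exact mul_le_of_le_one_left hh.le p.1.2.2
        · simp [p.2.2.2 i hi]⟩)
      (fun _ => ⟨c, by simp [boxCell, hh.le]⟩)
  have hqc : Continuous q := by
    refine continuous_sum_dom.2 ⟨?_, continuous_const⟩
    exact Continuous.subtype_mk (by fun_prop) _
  have hqs : Function.Surjective q := by
    intro y
    by_cases hy : y.1 = c
    · exact ⟨Sum.inr (), Subtype.ext hy.symm⟩
    · have hpos : 0 < ‖y.1 - c‖ := norm_pos_iff.2 (sub_ne_zero.2 hy)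
      refine ⟨Sum.inl (⟨‖y.1 - c‖ / h, by positivity, (div_le_one hh).2 y.2.1⟩,
        ⟨c + (h / ‖y.1 - c‖) • (y.1 - c), ?_, fun i hi => ?_⟩), Subtype.ext ?_⟩
      · rw [add_sub_cancel_left, norm_smul, Real.norm_of_nonneg (by positivity)]
        field_simp
      · simp [y.2.2 i hi]
      · simp only [q, Sum.elim_inl, add_sub_cancel_left, smul_smul]
        rw [div_mul_div_cancel₀ hh.ne', div_self hpos.ne', one_smul, add_sub_cancel]
  have : CompactSpace (boxBdry c h J) := isCompact_iff_compactSpace.1 (isCompact_boxBdry c h J)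
  have hq : IsQuotientMap q := hqc.isClosedMap.isQuotientMap hqc hqs
  -- At `y = c` the division by zero makes the argument of `k` equal to `c`, where `k` is
  -- uncontrolled; its coefficient is `0` there.
  let Γ : boxCell c h J → E := fun y =>
    (‖y.1 - c‖ / h) • k (c + (h / ‖y.1 - c‖) • (y.1 - c)) + (1 - ‖y.1 - c‖ / h) • v
  have hΓ : ∀ (t : Icc (0 : ℝ) 1) (b : boxBdry c h J),
      Γ (q (Sum.inl (t, b))) = t.1 • k b + (1 - t.1) • v := by
    intro t b
    simp only [Γ, q, Sum.elim_inl, add_sub_cancel_left, hnorm, mul_div_cancel_right₀ _ hh.ne']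
    rcases t.2.1.eq_or_lt with ht | ht
    · simp [← ht]
    · have hht : h / (t.1 * h) * t.1 = 1 := by field_simp
      rw [smul_smul, hht, one_smul, add_sub_cancel]
  have hΓc : ∀ u, Γ (q (Sum.inr u)) = v := by
    intro u
    simp [Γ, q]
  refine ⟨Γ, hq.continuous_iff.2 (continuous_sum_dom.2 ⟨?_, ?_⟩), fun y hy => ?_, fun y => ?_⟩
  · have : (Γ ∘ q) ∘ Sum.inl = fun p : Icc (0 : ℝ) 1 × boxBdry c h J =>
        p.1.1 • k p.2 + (1 - p.1.1) • v := by
      ext p; exact hΓ p.1 p.2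
    rw [this]
    have hk' : Continuous fun b : boxBdry c h J => k b := hk.domRestrict
    exact (by fun_prop : Continuous fun p : Icc (0 : ℝ) 1 × boxBdry c h J => p.1.1).smul
      (hk'.comp continuous_snd) |>.add (by fun_prop)
  · have : (Γ ∘ q) ∘ Sum.inr = fun _ => v := by
      ext u; exact hΓc u
    rw [this]
    exact continuous_const
  · simp [Γ, hy.1, div_self hh.ne']
  · obtain ⟨p | p, rfl⟩ := hqs y
    · rw [show p = (p.1, p.2) from rfl, hΓ]
      exact ⟨_, mem_insert_of_mem _ (mem_image_of_mem k p.2.2), v, mem_insert _ _, p.1, p.1.2, rfl⟩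
    · rw [hΓc]
      exact ⟨v, mem_insert _ _, v, mem_insert _ _, 1, by simp, by simp⟩

end Box

/-- Each continuous map from the boundary of a box to `W` extends to a continuous map from the box
to `N`. -/
def ConeExtends (ι : Type) [Fintype ι] {P : Type*} [TopologicalSpace P] (W N : Set P) : Prop :=
  ∀ (c : ι → ℝ) (h : ℝ) (J : Set ι), 0 < h → ∀ g : (ι → ℝ) → P,
    ContinuousOn g (boxBdry c h J) → MapsTo g (boxBdry c h J) W →
      ∃ G : boxCell c h J → P, Continuous G ∧
        (∀ y : boxCell c h J, y.1 ∈ boxBdry c h J → G y = g y) ∧ ∀ y, G y ∈ N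

/-! ### Filling spheres inside charts -/

/-- A map into the image of an embedding lifts. -/
theorem exists_lift_of_isEmbedding {Y P E : Type*} [TopologicalSpace Y] [TopologicalSpace P]
    [TopologicalSpace E] {U : Set P} {φ : P → E} (hφ : IsEmbedding (U.domRestrict φ))
    {Γ : Y → E} (hΓ : Continuous Γ) (hU : ∀ y, Γ y ∈ φ '' U) :
    ∃ G : Y → P, Continuous G ∧ (∀ y, G y ∈ U) ∧ ∀ y, φ (G y) = Γ y := by
  choose G hG using hU
  have : Continuous fun y => (⟨G y, (hG y).1⟩ : U) := by
    rw [hφ.isInducing.continuous_iff]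
    exact hΓ.congr fun y => (hG y).2.symm
  exact ⟨G, continuous_subtype_val.comp this, fun y => (hG y).1, fun y => (hG y).2⟩

/-- The segment map sends `[0,1] × {(v, v)}` to `v`, so compactness of `[0,1]` gives one
neighbourhood of `v` that works for all parameters. This replaces local convexity. -/
theorem exists_open_convTwo_subset {E : Type*} [AddCommGroup E] [Module ℝ E] [TopologicalSpace E]
    [IsTopologicalAddGroup E] [ContinuousSMul ℝ E] {W : Set E} (hW : IsOpen W) {v : E}
    (hv : v ∈ W) : ∃ W' : Set E, IsOpen W' ∧ v ∈ W' ∧ convTwo W' ⊆ W := by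
  have hcont : Continuous fun p : ℝ × (E × E) => p.1 • p.2.1 + (1 - p.1) • p.2.2 := by fun_prop
  have hsub : Icc (0 : ℝ) 1 ×ˢ {(v, v)} ⊆
      (fun p : ℝ × (E × E) => p.1 • p.2.1 + (1 - p.1) • p.2.2) ⁻¹' W := by
    rintro ⟨t, a, b⟩ ⟨-, hab⟩
    obtain ⟨rfl, rfl⟩ := Prod.mk.inj (mem_singleton_iff.1 hab)
    simpa [← add_smul] using hv
  obtain ⟨s, u, -, hu, hs, hvu, hsu⟩ :=
    generalized_tube_lemma isCompact_Icc isCompact_singleton (hW.preimage hcont) hsub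
  obtain ⟨a, b, ha, hb, hva, hvb, hab⟩ :=
    isOpen_prod_iff.1 hu v v (hvu (mem_singleton _))
  refine ⟨a ∩ b, ha.inter hb, ⟨hva, hvb⟩, ?_⟩
  rintro z ⟨y₁, h₁, y₂, h₂, t, ht, rfl⟩
  exact hsu (a := (t, (y₁, y₂))) ⟨hs ht, hab ⟨h₁.1, h₂.2⟩⟩

section Chart

variable {M : Type u} [TopologicalSpace M] {A : Type v} [Preorder A]
  {S : A →o Set M} [∀ α, TopologicalSpace (Step S α)]
  {E : Type w} [AddCommGroup E] [Module ℝ E] [TopologicalSpace E]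
  {Eα : A → Type w'} [∀ α, AddCommGroup (Eα α)] [∀ α, Module ℝ (Eα α)]
  [∀ α, TopologicalSpace (Eα α)]

/-- Inside a chart, each point has arbitrarily small neighbourhoods whose `conv₂` is controlled. -/
theorem WellFilledChart.exists_convTwo_nhd [IsTopologicalAddGroup E] [ContinuousSMul ℝ E]
    (c : WellFilledChart S E Eα) {q : M} (hq : q ∈ c.core) {N : Set M} (hN : IsOpen N)
    (hqN : q ∈ N) :
    ∃ W : Set M, IsOpen W ∧ q ∈ W ∧ W ⊆ c.core ∧ convTwo (c.φ '' W) ⊆ c.φ '' (c.U ∩ N) := by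
  obtain ⟨W₁, hW₁, hpre⟩ := c.isEmbedding_φ.isInducing.isOpen_iff.1
    (hN.preimage (continuous_subtype_val (p := (· ∈ c.U))))
  have hmem : ∀ x ∈ c.U, (c.φ x ∈ W₁ ↔ x ∈ N) := fun x hx =>
    Set.ext_iff.1 hpre ⟨x, hx⟩
  obtain ⟨W₂, hW₂, hqW₂, hconv⟩ := exists_open_convTwo_subset hW₁ ((hmem q hq.1).2 hqN)
  obtain ⟨W₃, hW₃, hV2⟩ := c.V2_relOpen
  have hφ : ContinuousOn c.φ c.U := continuousOn_iff_continuous_domRestrict.2 c.isEmbedding_φ.continuous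
  refine ⟨c.U ∩ c.φ ⁻¹' (W₂ ∩ W₃), hφ.isOpen_inter_preimage c.isOpen_U (hW₂.inter hW₃),
    ⟨hq.1, hqW₂, ?_⟩, fun x hx => ⟨hx.1, ?_⟩, ?_⟩
  · have := hq.2
    rw [hV2] at this
    exact this.1
  · rw [hV2]
    exact ⟨hx.2.2, mem_image_of_mem _ hx.1⟩
  · rintro z ⟨-, ⟨x₁, h₁, rfl⟩, -, ⟨x₂, h₂, rfl⟩, t, ht, rfl⟩
    have hmemV2 : ∀ x ∈ c.U ∩ c.φ ⁻¹' (W₂ ∩ W₃), c.φ x ∈ c.V2 := fun x hx => by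
      rw [hV2]
      exact ⟨hx.2.2, mem_image_of_mem _ hx.1⟩
    obtain ⟨x, hx, hxz⟩ := c.cond_e ⟨_, hmemV2 x₁ h₁, _, hmemV2 x₂ h₂, t, ht, rfl⟩
    refine ⟨x, ⟨hx, (hmem x hx).1 ?_⟩, hxz⟩
    rw [hxz]
    exact hconv ⟨_, h₁.2.1, _, h₂.2.1, t, ht, rfl⟩

/-- Maps into a small subset of the core extend over boxes. -/
theorem WellFilledChart.coneExtends [IsTopologicalAddGroup E] [ContinuousSMul ℝ E]
    (c : WellFilledChart S E Eα) (ι : Type) [Fintype ι] {W N : Set M} (hWc : W ⊆ c.core)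
    (hW : W.Nonempty) (hconv : convTwo (c.φ '' W) ⊆ c.φ '' (c.U ∩ N)) : ConeExtends ι W N := by
  intro a h J hh g hg hgW
  -- With the apex in `φ(W)`, every point of the cone is a two-point combination of points of
  -- `φ(W)`, which `hconv` controls.
  obtain ⟨x₀, hx₀⟩ := hW
  have hφ : ContinuousOn c.φ c.U := continuousOn_iff_continuous_domRestrict.2 c.isEmbedding_φ.continuous
  have hk : ContinuousOn (c.φ ∘ g) (boxBdry a h J) :=
    hφ.comp hg fun y hy => (hWc (hgW hy)).1
  obtain ⟨Γ, hΓ, hΓb, hΓc⟩ := exists_cone_extension a h J hh _ hk (c.φ x₀)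
  have hsub : insert (c.φ x₀) ((c.φ ∘ g) '' boxBdry a h J) ⊆ c.φ '' W := by
    refine insert_subset (mem_image_of_mem _ hx₀) ?_
    rintro _ ⟨y, hy, rfl⟩
    exact mem_image_of_mem _ (hgW hy)
  have hΓN : ∀ y, Γ y ∈ c.φ '' (c.U ∩ N) := fun y => by
    obtain ⟨y₁, h₁, y₂, h₂, t, ht, hz⟩ := hΓc y
    exact hconv ⟨y₁, hsub h₁, y₂, hsub h₂, t, ht, hz⟩
  have hinj : InjOn c.φ c.U := injOn_iff_injective.2 c.isEmbedding_φ.injective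
  obtain ⟨G, hG, hGU, hGΓ⟩ := exists_lift_of_isEmbedding c.isEmbedding_φ hΓ
    fun y => image_mono inter_subset_left (hΓN y)
  refine ⟨G, hG, fun y hy => ?_, fun y => ?_⟩
  · exact hinj (hGU y) (hWc (hgW hy)).1 ((hGΓ y).trans (hΓb y hy))
  · obtain ⟨x, hx, hxΓ⟩ := hΓN y
    rw [hinj (hGU y) hx.1 ((hGΓ y).trans hxΓ.symm)]
    exact hx.2

/-- A compact subset of the core lying in `M_∞` lies in some `U_γ`, and is compact there. -/
theorem WellFilledChart.exists_lift_to_step [IsDirectedOrder A] [TopologicalSpace (UnionSpace S)]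
    (htrans : ∀ (α β : A) (h : α ≤ β), Continuous (stepTrans S h))
    (hretractive : CompactlyRetractive S)
    (c : WellFilledChart S E Eα) {K : Set (UnionSpace S)} (hK : IsCompact K)
    (hKU : ∀ x ∈ K, unionIncl S x ∈ c.U) :
    ∃ γ, c.α₀ ≤ γ ∧ ∃ r : K → Step S γ, Continuous r ∧ (∀ x, stepToUnion S γ (r x) = x) ∧
      ∀ x, r x ∈ c.Uα γ := by
  obtain ⟨α, hα, htop⟩ := hretractive K hK
  have hr₀ : Continuous fun x : K => Step.mk S (unionIncl S x.1) (hα x.1 x.2) :=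
    continuous_iff_le_induced.2 htop.ge
  obtain ⟨β, hαβ, hβ⟩ := exists_ge_ge α c.α₀
  let r : ∀ γ : Ici β, K → Step S γ.1 := fun γ x =>
    stepTrans S (hαβ.trans γ.2) (Step.mk S (unionIncl S x.1) (hα x.1 x.2))
  have hr : ∀ γ, Continuous (r γ) := fun γ => (htrans _ _ _).comp hr₀
  have : CompactSpace K := isCompact_iff_compactSpace.1 hK
  -- The sets of points of `K` lying in `U_γ` form a directed open cover of `K` by (b) and (d), so a
  -- single `γ` suffices.
  have hmono : ∀ γ δ : Ici β, γ ≤ δ → r γ ⁻¹' c.Uα γ.1 ⊆ r δ ⁻¹' c.Uα δ.1 := by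
    intro γ δ hγδ x hx
    exact (c.cond_b γ.1 δ.1 (hβ.trans γ.2) hγδ _ hx).1
  have : Nonempty (Ici β) := ⟨⟨β, le_rfl⟩⟩
  have hdir : Directed (· ⊆ ·) fun γ : Ici β => r γ ⁻¹' c.Uα γ.1 := by
    intro γ δ
    obtain ⟨ε, h₁, h₂⟩ := exists_ge_ge γ.1 δ.1
    exact ⟨⟨ε, le_trans γ.2 h₁⟩, hmono _ _ h₁, hmono _ _ h₂⟩
  obtain ⟨γ, hγ⟩ := isCompact_univ.elim_directed_cover _
    (fun γ : Ici β => (c.isOpen_Uα γ.1 (hβ.trans γ.2)).preimage (hr γ)) (by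
      intro x _
      have hx : unionIncl S x.1 ∈ c.U ∩ ⋃ α, S α := ⟨hKU x.1 x.2, x.1.2⟩
      rw [← c.cond_d] at hx
      simp only [mem_iUnion] at hx
      obtain ⟨δ, hδ, y, hy, hyx⟩ := hx
      obtain ⟨ε, h₁, h₂⟩ := exists_ge_ge β δ
      refine mem_iUnion.2 ⟨⟨ε, h₁⟩, ?_⟩
      have hry : r ⟨ε, h₁⟩ x = stepTrans S h₂ y := Subtype.ext hyx.symm
      rw [mem_preimage, hry]
      exact (c.cond_b δ ε hδ h₂ y hy).1) hdir
  exact ⟨γ.1, hβ.trans γ.2, r γ, hr γ, fun x => rfl, fun x => hγ (mem_univ x)⟩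

/-- Maps into `M_∞` whose values lie in a small subset of the core extend over boxes. -/
theorem WellFilledChart.coneExtends_union [IsTopologicalAddGroup E] [ContinuousSMul ℝ E]
    [∀ α, IsTopologicalAddGroup (Eα α)] [∀ α, ContinuousSMul ℝ (Eα α)]
    [IsDirectedOrder A] [TopologicalSpace (UnionSpace S)]
    (htrans : ∀ (α β : A) (h : α ≤ β), Continuous (stepTrans S h))
    (hstepToUnion : ∀ α, Continuous (stepToUnion S α))
    (hretractive : CompactlyRetractive S)
    (c : WellFilledChart S E Eα) (ι : Type) [Fintype ι] {W N : Set M} (hWc : W ⊆ c.core)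
    (hW : (unionIncl S ⁻¹' W).Nonempty) (hconv : convTwo (c.φ '' W) ⊆ c.φ '' (c.U ∩ N)) :
    ConeExtends ι (unionIncl S ⁻¹' W) (unionIncl S ⁻¹' N) := by
  intro a h J hh g hg hgW
  obtain ⟨x₀, hx₀⟩ := hW
  -- The apex is included in the compact set, so that one application of (f) covers all segments of
  -- the cone.
  have hKc : IsCompact (insert x₀ (g '' boxBdry a h J)) :=
    ((isCompact_boxBdry a h J).image_of_continuousOn hg).insert x₀
  set K := insert x₀ (g '' boxBdry a h J) with hKdef
  have hx₀K : x₀ ∈ K := mem_insert _ _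
  have hgK : ∀ y ∈ boxBdry a h J, g y ∈ K := fun y hy =>
    mem_insert_of_mem _ (mem_image_of_mem g hy)
  have hKW : ∀ x ∈ K, unionIncl S x ∈ W := by
    rintro x (rfl | ⟨y, hy, rfl⟩)
    exacts [hx₀, hgW hy]
  obtain ⟨γ, hγ, r, hr, hrx, hrU⟩ := c.exists_lift_to_step htrans hretractive hKc
    fun x hx => (hWc (hKW x hx)).1
  have hrx' : ∀ x, stepIncl S γ (r x) = unionIncl S x.1 := fun x =>
    congrArg (unionIncl S) (hrx x)
  have hφγ : ∀ β, c.α₀ ≤ β → ContinuousOn (c.φα β) (c.Uα β) := fun β hβ =>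
    continuousOn_iff_continuous_domRestrict.2 (c.isEmbedding_φα β hβ).continuous
  have : CompactSpace K := isCompact_iff_compactSpace.1 hKc
  have hφr : Continuous fun x => c.φα γ (r x) := (hφγ γ hγ).comp_continuous hr hrU
  obtain ⟨β, hγβ, hβ⟩ := c.cond_f γ hγ (range fun x => c.φα γ (r x)) (isCompact_range hφr)
    (by rintro _ ⟨x, rfl⟩; exact mem_image_of_mem _ (hrU x))
    (by
      rintro _ ⟨_, ⟨x, rfl⟩, rfl⟩
      rw [← (c.cond_a γ hγ _ (hrU x)).2, hrx']
      exact (hWc (hKW x.1 x.2)).2)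
  have hγβ' := hγ.trans hγβ
  let s : K → Step S β := fun x => stepTrans S hγβ (r x)
  have hs : Continuous s := (htrans _ _ _).comp hr
  have hsU : ∀ x, s x ∈ c.Uα β := fun x => (c.cond_b γ β hγ hγβ _ (hrU x)).1
  have hsx : ∀ x, stepToUnion S β (s x) = x.1 := fun x => hrx x
  have hsx' : ∀ x, stepIncl S β (s x) = unionIncl S x.1 := fun x => hrx' x
  have hlam : ∀ x, c.lam β (c.φα β (s x)) = c.φ (unionIncl S x.1) := fun x => by
    rw [← (c.cond_a β hγβ' _ (hsU x)).2, hsx']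
  classical
  let k : (ι → ℝ) → Eα β := fun y =>
    if hy : y ∈ boxBdry a h J then c.φα β (s ⟨g y, hgK y hy⟩) else 0
  have hkb : ∀ y (hy : y ∈ boxBdry a h J), k y = c.φα β (s ⟨g y, hgK y hy⟩) := fun y hy =>
    dif_pos hy
  have hk : ContinuousOn k (boxBdry a h J) := by
    rw [continuousOn_iff_continuous_domRestrict]
    have h₁ : Continuous fun y : boxBdry a h J => (⟨g y, hgK y y.2⟩ : K) :=
      hg.domRestrict.subtype_mk _
    exact (((hφγ β hγβ').comp_continuous hs hsU).comp h₁).congr fun y => (hkb y.1 y.2).symm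
  obtain ⟨Γ, hΓ, hΓb, hΓc⟩ := exists_cone_extension a h J hh _ hk (c.φα β (s ⟨x₀, hx₀K⟩))
  have hsub : insert (c.φα β (s ⟨x₀, hx₀K⟩)) (k '' boxBdry a h J) ⊆
      range fun x => c.φα β (s x) := by
    refine insert_subset (mem_range_self _) ?_
    rintro _ ⟨y, hy, rfl⟩
    rw [hkb y hy]
    exact mem_range_self _
  have hΓV : ∀ y, Γ y ∈ c.φα β '' c.Uα β := fun y => by
    obtain ⟨y₁, h₁, y₂, h₂, t, ht, hz⟩ := hΓc y
    have hr' : ∀ z ∈ range (fun x => c.φα β (s x)),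
        z ∈ c.lamTrans γ β '' range fun x => c.φα γ (r x) := by
      rintro _ ⟨x, rfl⟩
      exact ⟨_, mem_range_self x, (c.cond_b γ β hγ hγβ _ (hrU x)).2.symm⟩
    exact hβ ⟨y₁, hr' _ (hsub h₁), y₂, hr' _ (hsub h₂), t, ht, hz⟩
  obtain ⟨G, hG, hGU, hGΓ⟩ := exists_lift_of_isEmbedding (c.isEmbedding_φα β hγβ') hΓ hΓV
  refine ⟨fun y => stepToUnion S β (G y), (hstepToUnion β).comp hG, fun y hy => ?_, fun y => ?_⟩
  · have hinj : InjOn (c.φα β) (c.Uα β) := injOn_iff_injective.2 (c.isEmbedding_φα β hγβ').injective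
    have : G y = s ⟨g y, hgK y hy⟩ :=
      hinj (hGU y) (hsU _) (by rw [hGΓ, hΓb y hy, hkb y.1 hy])
    simp only [this, hsx]
  · have hinj : InjOn c.φ c.U := injOn_iff_injective.2 c.isEmbedding_φ.injective
    obtain ⟨hyU, hyφ⟩ := c.cond_a β hγβ' _ (hGU y)
    obtain ⟨y₁, h₁, y₂, h₂, t, ht, hz⟩ := hΓc y
    have hr' : ∀ z ∈ range (fun x => c.φα β (s x)), c.lam β z ∈ c.φ '' W := by
      rintro _ ⟨x, rfl⟩
      simp only [hlam]
      exact mem_image_of_mem _ (hKW x.1 x.2)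
    -- Linearity of `λ_β` carries the segment in `E_β` to one between points of `φ(W)`, whose points
    -- have preimages in `N`; injectivity of `φ` identifies the preimage with `G y`.
    obtain ⟨x, hx, hxz⟩ := hconv ⟨_, hr' _ (hsub h₁), _, hr' _ (hsub h₂), t, ht, rfl⟩
    have : stepIncl S β (G y) = x := hinj hyU hx.1 (by
      rw [hyφ, hGΓ, hz, hxz, map_add, map_smul, map_smul])
    show stepIncl S β (G y) ∈ N
    rw [this]
    exact hx.2

end Chart

/-- Each neighbourhood `N` of a point contains a neighbourhood `W` such that spheres in `W` can be
filled in `N`, and spheres in `W ∩ M_∞` can be filled in `N ∩ M_∞`. -/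
theorem exists_coneExtends_nhd {M : Type u} [TopologicalSpace M]
    {A : Type v} [Preorder A] [IsDirectedOrder A]
    (S : A →o Set M) [∀ α, TopologicalSpace (Step S α)]
    (hdense : Dense (⋃ α, S α))
    (htrans : ∀ (α β : A) (h : α ≤ β), Continuous (stepTrans S h))
    (hcharts : AdmitsWellFilledCharts.{u, v, w, w'} S)
    [TopologicalSpace (UnionSpace S)]
    (hstepToUnion : ∀ α, Continuous (stepToUnion S α))
    (hretractive : CompactlyRetractive S) (ι : Type) [Fintype ι] (q : M) (N : Set M)
    (hN : IsOpen N) (hq : q ∈ N) :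
    ∃ W : Set M, IsOpen W ∧ q ∈ W ∧ ConeExtends ι W N ∧
      ConeExtends ι (unionIncl S ⁻¹' W) (unionIncl S ⁻¹' N) := by
  obtain ⟨E, _, _, _, _, _, _, Eα, _, _, _, _, _, _, c, hc⟩ := hcharts q
  obtain ⟨W, hW, hqW, hWc, hconv⟩ := c.exists_convTwo_nhd hc hN hq
  obtain ⟨x, hxW, hx⟩ := hdense.inter_open_nonempty W hW ⟨q, hqW⟩
  exact ⟨W, hW, hqW, c.coneExtends ι hWc ⟨q, hqW⟩ hconv,
    c.coneExtends_union htrans hstepToUnion hretractive ι hWc ⟨⟨x, hx⟩, hxW⟩ hconv⟩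

/-! ### Extension over a grid -/

/-- Two functions on closed pieces which agree where both are defined can be glued. -/
theorem exists_glue {X P : Type*} [TopologicalSpace X] [TopologicalSpace P] {D e : Set X}
    (hD : IsClosed D) (he : IsClosed e) {F : X → P} (hF : ContinuousOn F D) {F₁ : e → P}
    (hF₁ : Continuous F₁) (hagree : ∀ y : e, y.1 ∈ D → F₁ y = F y) :
    ∃ F' : X → P, ContinuousOn F' (D ∪ e) ∧ (∀ y ∈ D, F' y = F y) ∧ ∀ y : e, F' y = F₁ y := by
  classical
  let F' : X → P := fun y => if hy : y ∈ e then F₁ ⟨y, hy⟩ else F y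
  have he' : ∀ y : e, F' y = F₁ y := fun y => dif_pos y.2
  have hD' : ∀ y ∈ D, F' y = F y := fun y hy => by
    by_cases hye : y ∈ e
    · exact (he' ⟨y, hye⟩).trans (hagree ⟨y, hye⟩ hy)
    · exact dif_neg hye
  refine ⟨F', ContinuousOn.union_of_isClosed (hF.congr hD') ?_ hD he, hD', he'⟩
  rw [continuousOn_iff_continuous_domRestrict]
  exact hF₁.congr fun y => (he' y).symm

/-- Near a compact set, a neighbourhood `O` of the graph of `f` contains a smaller one `O'` such that
spheres in `O'` over small balls can be filled within `O`. -/
theorem exists_refinement {X M P : Type*} [PseudoMetricSpace X] [TopologicalSpace M]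
    [TopologicalSpace P] (σ : P → M) (ι : Type) [Fintype ι]
    (hloc : ∀ (q : M) (N : Set M), IsOpen N → q ∈ N → ∃ W : Set M, IsOpen W ∧ q ∈ W ∧
      ConeExtends ι W N ∧ ConeExtends ι (σ ⁻¹' W) (σ ⁻¹' N))
    {K : Set X} (hK : IsCompact K) {f : X → M} (hf : Continuous f) {O : Set (X × M)}
    (hO : IsOpen O) (hfO : ∀ y, (y, f y) ∈ O) :
    ∃ O' ⊆ O, IsOpen O' ∧ (∀ y, (y, f y) ∈ O') ∧ ∃ δ > 0, ∀ y₀ ∈ K, ∃ W N : Set M,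
      ConeExtends ι W N ∧ ConeExtends ι (σ ⁻¹' W) (σ ⁻¹' N) ∧
      ∀ y ∈ Metric.ball y₀ δ, ∀ p, ((y, p) ∈ O' → p ∈ W) ∧ (p ∈ N → (y, p) ∈ O) := by
  have hx : ∀ x : X, ∃ r > 0, ∃ W N : Set M, IsOpen W ∧ ConeExtends ι W N ∧
      ConeExtends ι (σ ⁻¹' W) (σ ⁻¹' N) ∧ (∀ y ∈ Metric.closedBall x r, f y ∈ W) ∧
      ∀ y ∈ Metric.closedBall x r, ∀ p ∈ N, (y, p) ∈ O := by
    intro x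
    obtain ⟨a, N, ha, hN, hxa, hxN, haN⟩ := isOpen_prod_iff.1 hO x (f x) (hfO x)
    obtain ⟨W, hW, hxW, h₁, h₂⟩ := hloc (f x) N hN hxN
    obtain ⟨r, hr, hball⟩ := Metric.nhds_basis_closedBall.mem_iff.1
      (((ha.inter (hW.preimage hf))).mem_nhds ⟨hxa, hxW⟩)
    exact ⟨r, hr, W, N, hW, h₁, h₂, fun y hy => (hball hy).2,
      fun y hy p hp => haN ⟨(hball hy).1, hp⟩⟩
  choose r hr W N hW h₁ h₂ hfW hNO using hx
  obtain ⟨s, -, hs⟩ := hK.elim_nhds_subcover (fun x => Metric.ball x (r x))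
    fun x _ => Metric.ball_mem_nhds x (hr x)
  obtain ⟨δ, hδ, hleb⟩ := lebesgue_number_lemma_of_metric (c := fun x : s => Metric.ball x.1 (r x.1))
    hK (fun _ => Metric.isOpen_ball) (by simpa [iUnion_subtype] using hs)
  -- Over each of the finitely many closed balls, `O'` demands values in the matching `W x`.
  -- Closedness of the balls makes the condition open, and the graph of `f` meets it by the choice
  -- of radii. By the Lebesgue number, a `δ`-ball lies in one of them.
  refine ⟨O ∩ ⋂ x ∈ s, {z | z.1 ∉ Metric.closedBall x (r x) ∨ z.2 ∈ W x}, inter_subset_left,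
    hO.inter (isOpen_biInter_finset fun x _ => ?_), fun y => ⟨hfO y, ?_⟩, δ, hδ, fun y₀ hy₀ => ?_⟩
  · exact (Metric.isClosed_closedBall.isOpen_compl.preimage continuous_fst).union
      ((hW x).preimage continuous_snd)
  · simp only [mem_iInter, mem_ofPred_eq]
    exact fun x _ => or_iff_not_imp_left.2 fun h => hfW x y (not_not.1 h)
  · obtain ⟨x, hx⟩ := hleb y₀ hy₀
    refine ⟨W x, N x, h₁ x, h₂ x, fun y hy p => ⟨fun hp => ?_, hNO x y ?_ p⟩⟩
    · have := mem_iInter₂.1 hp.2 x.1 x.2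
      exact this.resolve_left (not_not.2 (Metric.ball_subset_closedBall (hx hy)))
    · exact Metric.ball_subset_closedBall (hx hy)

/-- `F` is continuous on `D`, and `G` lifts it continuously over `D ∩ T`. -/
structure IsPartialLift {X M P : Type*} [TopologicalSpace X] [TopologicalSpace M]
    [TopologicalSpace P] (σ : P → M) (T D : Set X) (F : X → M) (G : X → P) : Prop where
  continuousOn : ContinuousOn F D
  continuousOn_lift : ContinuousOn G (D ∩ T)
  comp_eq : ∀ y ∈ D ∩ T, σ (G y) = F y

/-- A partial lift extends over one more box. -/
theorem IsPartialLift.exists_attach {ι : Type} [Fintype ι] {M P : Type*} [TopologicalSpace M]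
    [TopologicalSpace P] {σ : P → M} (hσ : Continuous σ) {T D : Set (ι → ℝ)} {F : (ι → ℝ) → M}
    {G : (ι → ℝ) → P} (hFG : IsPartialLift σ T D F G) (hT : IsClosed T) (hD : IsClosed D)
    {c : ι → ℝ} {h : ℝ} (hh : 0 < h) {J : Set ι} (hbD : boxBdry c h J ⊆ D)
    (hDb : boxCell c h J ∩ D ⊆ boxBdry c h J)
    (heT : boxCell c h J ⊆ T ∨ boxCell c h J ∩ T ⊆ boxBdry c h J) {W N : Set M}
    (h₁ : ConeExtends ι W N) (h₂ : ConeExtends ι (σ ⁻¹' W) (σ ⁻¹' N))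
    (hFW : MapsTo F (boxBdry c h J) W) :
    ∃ F' G', IsPartialLift σ T (D ∪ boxCell c h J) F' G' ∧ (∀ y ∈ D, F' y = F y) ∧
      (∀ y ∈ D ∩ T, G' y = G y) ∧ ∀ y ∈ boxCell c h J, F' y ∈ N := by
  have hec : IsClosed (boxCell c h J) := (isCompact_boxCell c h J).isClosed
  -- A cell inside `T` is filled upstairs and `F'` is its image under `σ`; otherwise the cell meets
  -- `T` only in its boundary, where `G` is already defined, and is filled in `M`.
  rcases heT with heT | heT
  · have hbDT : boxBdry c h J ⊆ D ∩ T := fun y hy => ⟨hbD hy, heT (boxBdry_subset c h J hy)⟩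
    obtain ⟨G₁, hG₁, hG₁b, hG₁N⟩ := h₂ c h J hh G (hFG.continuousOn_lift.mono hbDT) fun y hy => by
      rw [mem_preimage, hFG.comp_eq y (hbDT hy)]
      exact hFW hy
    obtain ⟨G', hG', hG'D, hG'e⟩ := exists_glue (hD.inter hT) hec hFG.continuousOn_lift hG₁
      fun y hy => hG₁b y (hDb ⟨y.2, hy.1⟩)
    obtain ⟨F', hF', hF'D, hF'e⟩ := exists_glue hD hec hFG.continuousOn (hσ.comp hG₁)
      fun y hy => by
        rw [Function.comp_apply, hG₁b y (hDb ⟨y.2, hy⟩), hFG.comp_eq y ⟨hy, heT y.2⟩]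
    have hset : (D ∪ boxCell c h J) ∩ T = (D ∩ T) ∪ boxCell c h J := by
      rw [union_inter_distrib_right, inter_eq_left.2 heT]
    refine ⟨F', G', ⟨hF', hset ▸ hG', ?_⟩, hF'D, hG'D, fun y hy => ?_⟩
    · rw [hset]
      rintro y (hy | hy)
      · rw [hG'D y hy, hF'D y hy.1, hFG.comp_eq y hy]
      · rw [hG'e ⟨y, hy⟩, hF'e ⟨y, hy⟩, Function.comp_apply]
    · rw [hF'e ⟨y, hy⟩]
      exact hG₁N _
  · obtain ⟨F₁, hF₁, hF₁b, hF₁N⟩ := h₁ c h J hh F (hFG.continuousOn.mono hbD) hFW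
    obtain ⟨F', hF', hF'D, hF'e⟩ := exists_glue hD hec hFG.continuousOn hF₁
      fun y hy => hF₁b y (hDb ⟨y.2, hy⟩)
    have hset : (D ∪ boxCell c h J) ∩ T = D ∩ T := by
      rw [union_inter_distrib_right, union_eq_left]
      exact fun y hy => ⟨hbD (heT hy), hy.2⟩
    refine ⟨F', G, ⟨hF', hset ▸ hFG.continuousOn_lift, ?_⟩, hF'D, fun _ _ => rfl, fun y hy => ?_⟩
    · rw [hset]
      exact fun y hy => by rw [hF'D y hy.1, hFG.comp_eq y hy]
    · rw [hF'e ⟨y, hy⟩]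
      exact hF₁N _

/-! ### The cubical grid -/

section Grid

variable {ι : Type} [Fintype ι]

/-- The cell with index `j` of the grid of half-width `h`: odd indices mark the directions in which
the cell extends, even indices the vertices. -/
def gridCell (h : ℝ) (j : ι → ℕ) : Set (ι → ℝ) := boxCell (fun i => j i * h) h {i | Odd (j i)}

/-- The relative boundary of `gridCell h j`. -/
def gridBdry (h : ℝ) (j : ι → ℕ) : Set (ι → ℝ) := boxBdry (fun i => j i * h) h {i | Odd (j i)}

/-- The dimension of `gridCell h j`. -/
def gridDim (j : ι → ℕ) : ℕ := (Finset.univ.filter fun i => Odd (j i)).card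

/-- The union of the cells of dimension `< k` in the cube `[0, 2Nh]^ι`. -/
def gridSkeleton (ι : Type) [Fintype ι] (h : ℝ) (N k : ℕ) : Set (ι → ℝ) :=
  ⋃ j ∈ {j : ι → ℕ | (∀ i, j i ≤ 2 * N) ∧ gridDim j < k}, gridCell h j

theorem finite_gridIndex (ι : Type) [Fintype ι] (N : ℕ) : {j : ι → ℕ | ∀ i, j i ≤ 2 * N}.Finite :=
  Set.Finite.pi' fun _ => Set.finite_Iic (2 * N)

theorem isClosed_gridCell (h : ℝ) (j : ι → ℕ) : IsClosed (gridCell h j) :=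
  (isCompact_boxCell _ _ _).isClosed

theorem isClosed_gridSkeleton (h : ℝ) (N k : ℕ) : IsClosed (gridSkeleton ι h N k) :=
  ((finite_gridIndex ι N).subset fun _ hj => hj.1).isClosed_biUnion fun j _ => isClosed_gridCell h j

theorem abs_sub_le_of_mem_gridCell {h : ℝ} {j : ι → ℕ} {y : ι → ℝ} (hy : y ∈ gridCell h j) (i : ι) :
    |y i - j i * h| ≤ h :=
  (norm_le_pi_norm (y - fun i => j i * h) i).trans hy.1

theorem eq_of_mem_gridCell {h : ℝ} {j : ι → ℕ} {y : ι → ℝ} (hy : y ∈ gridCell h j) {i : ι}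
    (hi : Even (j i)) : y i = j i * h :=
  hy.2 i (by simpa using hi)

theorem abs_sub_lt_of_mem_gridCell {h : ℝ} (hh : 0 < h) {j : ι → ℕ} {y : ι → ℝ}
    (hy : y ∈ gridCell h j) (hyb : y ∉ gridBdry h j) (i : ι) : |y i - j i * h| < h := by
  have : ‖y - fun i => j i * h‖ < h := lt_of_le_of_ne hy.1 fun h' => hyb ⟨h', hy.2⟩
  exact (pi_norm_lt_iff hh).1 this i

/-- A point in the interior of a cell lies in no other cell of the same or smaller dimension. -/
theorem eq_of_mem_gridCell_of_notMem_bdry {h : ℝ} (hh : 0 < h) {j j' : ι → ℕ} {y : ι → ℝ}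
    (hy : y ∈ gridCell h j) (hyb : y ∉ gridBdry h j) (hy' : y ∈ gridCell h j')
    (hdim : gridDim j' ≤ gridDim j) : j' = j := by
  -- Strict inequality in the odd directions puts the two indices less than `2` apart if both are
  -- odd and less than `1` apart if `j' i` is even; parity then leaves only equality.
  have hodd : ∀ i, Odd (j i) → Odd (j' i) ∧ j' i = j i := by
    intro i hi
    have h₁ := abs_lt.1 (abs_sub_lt_of_mem_gridCell hh hy hyb i)
    by_cases hi' : Odd (j' i)
    · refine ⟨hi', ?_⟩
      have h₂ := abs_le.1 (abs_sub_le_of_mem_gridCell hy' i)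
      have a : (j' i : ℝ) < j i + 2 := by nlinarith
      have b : (j i : ℝ) < j' i + 2 := by nlinarith
      have a' : j' i < j i + 2 := by exact_mod_cast a
      have b' : j i < j' i + 2 := by exact_mod_cast b
      obtain ⟨x, hx⟩ := hi
      obtain ⟨z, hz⟩ := hi'
      omega
    · exfalso
      rw [Nat.not_odd_iff_even] at hi'
      rw [eq_of_mem_gridCell hy' hi'] at h₁
      have a : (j' i : ℝ) < j i + 1 := by nlinarith
      have b : (j i : ℝ) < j' i + 1 := by nlinarith
      have a' : j' i < j i + 1 := by exact_mod_cast a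
      have b' : j i < j' i + 1 := by exact_mod_cast b
      obtain ⟨x, hx⟩ := hi
      obtain ⟨z, hz⟩ := hi'
      omega
  have hsub : (Finset.univ.filter fun i => Odd (j i)) ⊆ Finset.univ.filter fun i => Odd (j' i) := by
    intro i hi
    simpa using (hodd i (by simpa using hi)).1
  have heq := Finset.eq_of_subset_of_card_le hsub hdim
  funext i
  by_cases hi : Odd (j i)
  · exact (hodd i hi).2
  · have hi' : ¬ Odd (j' i) := fun h' => hi (by
      have : i ∈ Finset.univ.filter fun i => Odd (j' i) := by simpa using h'
      rw [← heq] at this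
      simpa using this)
    rw [Nat.not_odd_iff_even] at hi hi'
    have := (eq_of_mem_gridCell hy hi).symm.trans (eq_of_mem_gridCell hy' hi')
    exact_mod_cast (mul_right_cancel₀ hh.ne' this).symm

/-- In the sup norm a boundary point is at distance exactly `h` from the centre in some coordinate.
Moving the index to the neighbouring even value in all such coordinates gives a proper face
containing the point. -/
theorem gridBdry_subset_skeleton {h : ℝ} (hh : 0 < h) {N : ℕ} {j : ι → ℕ}
    (hj : ∀ i, j i ≤ 2 * N) : gridBdry h j ⊆ gridSkeleton ι h N (gridDim j) := by
  classical
  intro y hy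
  have hyc : y ∈ gridCell h j := boxBdry_subset _ _ _ hy
  let j' : ι → ℕ := fun i =>
    if y i = (j i + 1) * h then j i + 1 else if y i = (j i - 1) * h then j i - 1 else j i
  have hcase : ∀ i, (Odd (j i) ∧ Even (j' i) ∧ y i = j' i * h ∧ j' i ≤ 2 * N) ∨
      (j' i = j i ∧ |y i - j i * h| < h) := by
    intro i
    by_cases hi : Odd (j i)
    · have hjN := hj i
      by_cases ha : y i = (j i + 1) * h
      · have hj' : j' i = j i + 1 := if_pos ha
        refine Or.inl ⟨hi, ?_, ?_, ?_⟩
        · rw [hj']; exact hi.add_one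
        · rw [hj']; push_cast; exact ha
        · obtain ⟨x, hx⟩ := hi
          omega
      · by_cases hb : y i = (j i - 1) * h
        · have hj' : j' i = j i - 1 := by simp only [j', if_neg ha, if_pos hb]
          refine Or.inl ⟨hi, ?_, ?_, by omega⟩
          · rw [hj']; exact Nat.Odd.sub_odd hi odd_one
          · rw [hj', Nat.cast_sub hi.pos]; push_cast; exact hb
        · refine Or.inr ⟨by simp only [j', if_neg ha, if_neg hb], ?_⟩
          refine lt_of_le_of_ne (abs_sub_le_of_mem_gridCell hyc i) fun habs => ?_
          rcases (abs_eq hh.le).1 habs with h' | h'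
          · exact ha (by linarith)
          · exact hb (by linarith)
    · rw [Nat.not_odd_iff_even] at hi
      have hyi := eq_of_mem_gridCell hyc hi
      refine Or.inr ⟨?_, by rw [hyi]; simpa using hh⟩
      have ha : y i ≠ (j i + 1) * h := by rw [hyi]; intro h'; linarith
      have hb : y i ≠ (j i - 1) * h := by rw [hyi]; intro h'; linarith
      simp only [j', if_neg ha, if_neg hb]
  simp only [gridSkeleton, mem_iUnion]
  refine ⟨j', ⟨fun i => ?_, ?_⟩, ⟨(pi_norm_le_iff_of_nonneg hh.le).2 fun i => ?_, fun i hi => ?_⟩⟩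
  · rcases hcase i with h' | h'
    · exact h'.2.2.2
    · rw [h'.1]; exact hj i
  · refine Finset.card_lt_card (Finset.ssubset_iff_subset_ne.2 ⟨fun i hi => ?_, fun heq => ?_⟩)
    · have hi' : Odd (j' i) := by simpa using hi
      rcases hcase i with h' | h'
      · exact absurd h'.2.1 (Nat.not_even_iff_odd.2 hi')
      · simpa [← h'.1] using hi'
    · refine absurd hy.1 (ne_of_lt ((pi_norm_lt_iff hh).2 fun i => ?_))
      rcases hcase i with h' | h'
      · have : i ∈ Finset.univ.filter fun i => Odd (j i) := by simpa using h'.1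
        rw [← heq] at this
        exact absurd h'.2.1 (Nat.not_even_iff_odd.2 (by simpa using this))
      · exact h'.2
  · rcases hcase i with h' | h'
    · simpa [h'.2.2.1] using hh.le
    · simpa [h'.1] using h'.2.le
  · have hi' : Even (j' i) := by simpa using hi
    rcases hcase i with h' | h'
    · exact h'.2.2.1
    · show y i = j' i * h
      rw [h'.1] at hi' ⊢
      exact eq_of_mem_gridCell hyc hi'

/-- A set is cellular if it is met by the interior of a grid cell of the unit cube only if it contains
the cell. -/
def IsCellular (Z : Set (ι → ℝ)) : Prop :=
  ∀ (N : ℕ) (h : ℝ), 0 < h → 2 * N * h = 1 → ∀ j : ι → ℕ, (∀ i, j i ≤ 2 * N) →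
    gridCell h j ⊆ Z ∨ gridCell h j ∩ Z ⊆ gridBdry h j

theorem isCellular_univ : IsCellular (univ : Set (ι → ℝ)) :=
  fun _ _ _ _ _ _ => Or.inl (subset_univ _)

theorem IsCellular.union {Z Z' : Set (ι → ℝ)} (hZ : IsCellular Z) (hZ' : IsCellular Z') :
    IsCellular (Z ∪ Z') := by
  intro N h hh hN j hj
  rcases hZ N h hh hN j hj with h₁ | h₁
  · exact Or.inl (h₁.trans subset_union_left)
  rcases hZ' N h hh hN j hj with h₂ | h₂
  · exact Or.inl (h₂.trans subset_union_right)
  · right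
    rw [inter_union_distrib_left]
    exact union_subset h₁ h₂

theorem IsCellular.iUnion {κ : Type*} {Z : κ → Set (ι → ℝ)} (hZ : ∀ i, IsCellular (Z i)) :
    IsCellular (⋃ i, Z i) := by
  intro N h hh hN j hj
  by_cases hex : ∃ i, gridCell h j ⊆ Z i
  · obtain ⟨i, hi⟩ := hex
    exact Or.inl (hi.trans (subset_iUnion Z i))
  · right
    rw [inter_iUnion]
    exact iUnion_subset fun i => (hZ i N h hh hN j hj).resolve_left fun h' => hex ⟨i, h'⟩

/-- Since `2 * N * h = 1`, the hyperplane sits at the even grid index `2 * N * ε`. A cell can meet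
it only at an end of an odd interval, or else with a constant coordinate. -/
theorem isCellular_facet (i : ι) (ε : ℕ) : IsCellular {y : ι → ℝ | y i = ε} := by
  intro N h hh hN j hj
  by_cases hi : Even (j i)
  · by_cases hji : (j i : ℝ) * h = ε
    · exact Or.inl fun y hy => (eq_of_mem_gridCell hy hi).trans hji
    · exact Or.inr fun y hy => absurd ((eq_of_mem_gridCell hy.1 hi).symm.trans hy.2) hji
  · refine Or.inr fun y hy => ?_
    by_contra hyb
    have h₁ := abs_lt.1 (abs_sub_lt_of_mem_gridCell hh hy.1 hyb i)
    rw [show y i = ε from hy.2, show (ε : ℝ) = (2 * N * ε : ℕ) * h by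
      push_cast; linear_combination -(ε : ℝ) * hN] at h₁
    have a : ((2 * N * ε : ℕ) : ℝ) < j i + 1 := by nlinarith
    have b : (j i : ℝ) < (2 * N * ε : ℕ) + 1 := by nlinarith
    have a' : 2 * N * ε < j i + 1 := by exact_mod_cast a
    have b' : j i < 2 * N * ε + 1 := by exact_mod_cast b
    refine hi ?_
    rw [show j i = 2 * N * ε by omega, mul_assoc]
    exact even_two_mul _

theorem Icc_subset_gridSkeleton {h : ℝ} (hh : 0 < h) {N : ℕ} (hN : 2 * N * h = 1) :
    Icc (0 : ι → ℝ) 1 ⊆ gridSkeleton ι h N (Fintype.card ι + 1) := by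
  intro y hy
  have hN0 : 0 < N := Nat.pos_of_ne_zero fun h0 => by simp [h0] at hN
  have hex : ∀ i, ∃ a : ℕ, a < N ∧ |y i - (2 * a + 1 : ℕ) * h| ≤ h := by
    intro i
    have hy0 : 0 ≤ y i := hy.1 i
    have hy1 : y i ≤ 1 := hy.2 i
    have hpos : 0 ≤ y i / (2 * h) := by positivity
    have hdiv : y i / (2 * h) * (2 * h) = y i := by field_simp
    by_cases hlt : ⌊y i / (2 * h)⌋₊ < N
    · refine ⟨_, hlt, ?_⟩
      have h₁ := Nat.floor_le hpos
      have h₂ := Nat.lt_floor_add_one (y i / (2 * h))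
      rw [abs_le]
      push_cast
      constructor <;> nlinarith
    -- Only `y i = 1` occurs here; the last interval contains it.
    · have h₁ : (N : ℝ) ≤ y i / (2 * h) := (Nat.le_floor_iff hpos).1 (not_lt.1 hlt)
      refine ⟨N - 1, by omega, ?_⟩
      have h₃ : ((2 * (N - 1) + 1 : ℕ) : ℝ) = 2 * N - 1 := by
        rw [show 2 * (N - 1) + 1 = 2 * N - 1 by omega, Nat.cast_sub (by omega)]
        push_cast; ring
      rw [h₃, abs_le]
      constructor <;> nlinarith
  choose a ha hya using hex
  simp only [gridSkeleton, mem_iUnion]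
  refine ⟨fun i => 2 * a i + 1, ⟨fun i => ?_, ?_⟩,
    (pi_norm_le_iff_of_nonneg hh.le).2 hya, fun i hi => ?_⟩
  · have := ha i
    show 2 * a i + 1 ≤ 2 * N
    omega
  · exact Nat.lt_succ_of_le (Finset.card_filter_le _ _)
  · exact absurd ⟨a i, rfl⟩ hi

end Grid

/-! ### Extending partial lifts skeleton by skeleton -/

section Extension

variable {ι : Type} [Fintype ι] {M P : Type*} [TopologicalSpace M] [TopologicalSpace P]
  {σ : P → M} {T Z : Set (ι → ℝ)}

/-- A partial lift over `Z` and the skeleton of dimension `< k` extends over the cells of dimension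
`k`. -/
theorem IsPartialLift.exists_skeleton_succ (hσ : Continuous σ) (hT : IsClosed T)
    (hTc : IsCellular T) (hZ : IsClosed Z) (hZc : IsCellular Z) {O O' : Set ((ι → ℝ) × M)}
    (hO : O' ⊆ O) {δ : ℝ}
    (hδO : ∀ y₀ ∈ Icc (0 : ι → ℝ) 1, ∃ W N : Set M,
      ConeExtends ι W N ∧ ConeExtends ι (σ ⁻¹' W) (σ ⁻¹' N) ∧
      ∀ y ∈ Metric.ball y₀ δ, ∀ p, ((y, p) ∈ O' → p ∈ W) ∧ (p ∈ N → (y, p) ∈ O))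
    {N : ℕ} {h : ℝ} (hh : 0 < h) (hN : 2 * N * h = 1) (hhδ : h < δ) (k : ℕ)
    {F : (ι → ℝ) → M} {G : (ι → ℝ) → P} (hFG : IsPartialLift σ T (gridSkeleton ι h N k ∪ Z) F G)
    (hFO : ∀ y ∈ gridSkeleton ι h N k ∪ Z, (y, F y) ∈ O') :
    ∃ F' G', IsPartialLift σ T (gridSkeleton ι h N (k + 1) ∪ Z) F' G' ∧ (∀ y ∈ Z, F' y = F y) ∧
      (∀ y ∈ Z ∩ T, G' y = G y) ∧ ∀ y ∈ gridSkeleton ι h N (k + 1) ∪ Z, (y, F' y) ∈ O := by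
  have hfin : {j : ι → ℕ | (∀ i, j i ≤ 2 * N) ∧ gridDim j = k}.Finite :=
    (finite_gridIndex ι N).subset fun _ hj => hj.1
  have hskel : gridSkeleton ι h N (k + 1) ∪ Z = gridSkeleton ι h N k ∪ Z ∪
      ⋃ j ∈ {j : ι → ℕ | (∀ i, j i ≤ 2 * N) ∧ gridDim j = k}, gridCell h j := by
    rw [union_right_comm]
    congr 1
    ext y
    simp only [gridSkeleton, mem_iUnion, mem_union, mem_ofPred_eq, exists_prop, ← exists_or,
      ← or_and_right, ← and_or_left, Nat.lt_succ_iff_lt_or_eq]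
  rw [hskel]
  set D := gridSkeleton ι h N k ∪ Z
  have hD : IsClosed D := (isClosed_gridSkeleton h N k).union hZ
  suffices H : ∃ F' G', IsPartialLift σ T
      (D ∪ ⋃ j ∈ {j : ι → ℕ | (∀ i, j i ≤ 2 * N) ∧ gridDim j = k}, gridCell h j) F' G' ∧
      (∀ y ∈ D, F' y = F y) ∧ (∀ y ∈ D ∩ T, G' y = G y) ∧
      ∀ y ∈ D ∪ ⋃ j ∈ {j : ι → ℕ | (∀ i, j i ≤ 2 * N) ∧ gridDim j = k}, gridCell h j,
        (y, F' y) ∈ O by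
    obtain ⟨F', G', h₁, h₂, h₃, h₄⟩ := H
    exact ⟨F', G', h₁, fun y hy => h₂ y (Or.inr hy), fun y hy => h₃ y ⟨Or.inr hy.1, hy.2⟩, h₄⟩
  refine hfin.induction_on_subset (motive := fun s _ => ∃ F' G', IsPartialLift σ T
      (D ∪ ⋃ j ∈ s, gridCell h j) F' G' ∧ (∀ y ∈ D, F' y = F y) ∧ (∀ y ∈ D ∩ T, G' y = G y) ∧
      ∀ y ∈ D ∪ ⋃ j ∈ s, gridCell h j, (y, F' y) ∈ O) _ ?_ ?_
  · simp only [mem_empty_iff_false, iUnion_of_empty, iUnion_empty, union_empty]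
    exact ⟨F, G, hFG, fun _ _ => rfl, fun _ _ => rfl, fun y hy => hO (hFO y hy)⟩
  · rintro j s ⟨hjN, hjk⟩ hs hjs ⟨F', G', h₁, h₂, h₃, h₄⟩
    rw [biUnion_insert, union_comm (gridCell h j), ← union_assoc]
    set D' := D ∪ ⋃ j ∈ s, gridCell h j
    have hD' : IsClosed D' :=
      hD.union ((hfin.subset hs).isClosed_biUnion fun j _ => isClosed_gridCell h j)
    have hDD' : D ⊆ D' := subset_union_left
    -- Cells inside `Z` are not refilled, since the prescribed values must survive there.
    rcases hZc N h hh hN j hjN with hjZ | hjZ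
    · rw [union_eq_left.2 (hjZ.trans (subset_union_right.trans hDD'))]
      exact ⟨F', G', h₁, h₂, h₃, h₄⟩
    -- The boundary lies in the old set `D`, not merely in `D'`: there `F'` equals `F`, whose graph
    -- is in the smaller neighbourhood `O'`.
    have hbD : gridBdry h j ⊆ D := fun y hy =>
      Or.inl (hjk ▸ gridBdry_subset_skeleton hh hjN hy)
    have hcb : ∀ y ∈ gridCell h j, ∀ j', y ∈ gridCell h j' → gridDim j' ≤ gridDim j → j' ≠ j →
        y ∈ gridBdry h j := fun y hy j' hy' hdim hne => by
      by_contra hyb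
      exact hne (eq_of_mem_gridCell_of_notMem_bdry hh hy hyb hy' hdim)
    have hDb : gridCell h j ∩ D' ⊆ gridBdry h j := by
      rintro y ⟨hy, (hy' | hy') | hy'⟩
      · simp only [gridSkeleton, mem_iUnion] at hy'
        obtain ⟨j', ⟨-, hj'⟩, hyj'⟩ := hy'
        exact hcb y hy j' hyj' (hjk ▸ hj'.le) fun hne => by rw [hne] at hj'; omega
      · exact hjZ ⟨hy, hy'⟩
      · simp only [mem_iUnion] at hy'
        obtain ⟨j', hj', hyj'⟩ := hy'
        exact hcb y hy j' hyj' ((hs hj').2.trans hjk.symm).le fun hne => hjs (hne ▸ hj')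
    have hcen : (fun i => (j i : ℝ) * h) ∈ Icc (0 : ι → ℝ) 1 := by
      refine ⟨fun i => by simp only [Pi.zero_apply]; positivity, fun i => ?_⟩
      have : (j i : ℝ) ≤ 2 * N := by exact_mod_cast hjN i
      show (j i : ℝ) * h ≤ 1
      rw [← hN]
      gcongr
    obtain ⟨W, V, hW₁, hW₂, hball⟩ := hδO _ hcen
    have hsub : gridCell h j ⊆ Metric.ball (fun i => (j i : ℝ) * h) δ := fun y hy => by
      rw [Metric.mem_ball, dist_eq_norm]
      exact hy.1.trans_lt hhδ
    have hbW : MapsTo F' (gridBdry h j) W := fun y hy => by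
      rw [h₂ y (hbD hy)]
      exact (hball y (hsub (boxBdry_subset _ _ _ hy)) _).1 (hFO y (hbD hy))
    obtain ⟨F'', G'', k₁, k₂, k₃, k₄⟩ := h₁.exists_attach hσ hT hD' hh (hbD.trans hDD') hDb
      (hTc N h hh hN j hjN) hW₁ hW₂ hbW
    refine ⟨F'', G'', k₁, fun y hy => (k₂ y (hDD' hy)).trans (h₂ y hy),
      fun y hy => (k₃ y ⟨hDD' hy.1, hy.2⟩).trans (h₃ y hy), ?_⟩
    rintro y (hy | hy)
    · rw [k₂ y hy]
      exact h₄ y hy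
    · exact (hball y (hsub hy) _).2 (k₄ y hy)

/-- The neighbourhoods are chosen backwards, from the top dimension down, before the grid and the
maps. Each dimension costs one refinement and one bound on `h`; the final `δ` is their minimum. -/
theorem exists_skeleton_extension (hσ : Continuous σ)
    (hloc : ∀ (q : M) (N : Set M), IsOpen N → q ∈ N → ∃ W : Set M, IsOpen W ∧ q ∈ W ∧
      ConeExtends ι W N ∧ ConeExtends ι (σ ⁻¹' W) (σ ⁻¹' N))
    (hT : IsClosed T) (hTc : IsCellular T) (hZ : IsClosed Z) (hZc : IsCellular Z)
    {f : (ι → ℝ) → M} (hf : Continuous f) (k : ℕ) : ∀ O : Set ((ι → ℝ) × M), IsOpen O →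
    (∀ y, (y, f y) ∈ O) → ∃ O', IsOpen O' ∧ (∀ y, (y, f y) ∈ O') ∧ ∃ δ > 0, ∀ (N : ℕ) (h : ℝ),
      0 < h → 2 * N * h = 1 → h < δ → ∀ F G, IsPartialLift σ T Z F G → (∀ y ∈ Z, (y, F y) ∈ O') →
        ∃ F' G', IsPartialLift σ T (gridSkeleton ι h N k ∪ Z) F' G' ∧ (∀ y ∈ Z, F' y = F y) ∧
          (∀ y ∈ Z ∩ T, G' y = G y) ∧ ∀ y ∈ gridSkeleton ι h N k ∪ Z, (y, F' y) ∈ O := by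
  induction k with
  | zero =>
    refine fun O hO hfO => ⟨O, hO, hfO, 1, one_pos, fun N h _ _ _ F G hFG hF => ⟨F, G, ?_⟩⟩
    simpa [gridSkeleton] using ⟨hFG, hF⟩
  | succ k ih =>
    intro O hO hfO
    obtain ⟨O₁, hO₁O, hO₁, hfO₁, δ₁, hδ₁, h₁⟩ :=
      exists_refinement σ ι hloc (isCompact_Icc (a := (0 : ι → ℝ)) (b := 1)) hf hO hfO
    obtain ⟨O₂, hO₂, hfO₂, δ₂, hδ₂, h₂⟩ := ih O₁ hO₁ hfO₁
    refine ⟨O₂, hO₂, hfO₂, min δ₁ δ₂, lt_min hδ₁ hδ₂, fun N h hh hN hhδ F G hFG hF => ?_⟩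
    obtain ⟨F', G', k₁, k₂, k₃, k₄⟩ := h₂ N h hh hN (hhδ.trans_le (min_le_right _ _)) F G hFG hF
    obtain ⟨F'', G'', l₁, l₂, l₃, l₄⟩ := k₁.exists_skeleton_succ hσ hT hTc hZ hZc hO₁O h₁ hh hN
      (hhδ.trans_le (min_le_left _ _)) k k₄
    exact ⟨F'', G'', l₁, fun y hy => (l₂ y hy).trans (k₂ y hy),
      fun y hy => (l₃ y hy).trans (k₃ y hy), l₄⟩

/-- The extension theorem: if spheres can be filled locally in `M` and in `P`, a map `f` of the cube
to `M` which is lifted to `P` on `Z ∩ T` can be changed off `Z` so that the lift extends to `T`. -/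
theorem exists_cube_extension (hσ : Continuous σ)
    (hloc : ∀ (q : M) (N : Set M), IsOpen N → q ∈ N → ∃ W : Set M, IsOpen W ∧ q ∈ W ∧
      ConeExtends ι W N ∧ ConeExtends ι (σ ⁻¹' W) (σ ⁻¹' N))
    (hT : IsClosed T) (hTc : IsCellular T) (hZ : IsClosed Z) (hZc : IsCellular Z)
    {f : (ι → ℝ) → M} (hf : Continuous f) {g : (ι → ℝ) → P} (hg : ContinuousOn g (Z ∩ T))
    (hgf : ∀ y ∈ Z ∩ T, σ (g y) = f y) :
    ∃ F G, IsPartialLift σ T (Icc 0 1) F G ∧ (∀ y ∈ Z, F y = f y) ∧ ∀ y ∈ Z ∩ T, G y = g y := by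
  obtain ⟨O, -, hfO, δ, hδ, H⟩ := exists_skeleton_extension hσ hloc hT hTc hZ hZc hf
    (Fintype.card ι + 1) univ isOpen_univ fun _ => mem_univ _
  obtain ⟨n, hn⟩ := exists_nat_one_div_lt hδ
  have hh : (0 : ℝ) < 1 / (2 * (n + 1 : ℕ)) := by positivity
  have hN : 2 * ((n + 1 : ℕ) : ℝ) * (1 / (2 * (n + 1 : ℕ))) = 1 := by
    field_simp
  have hhδ : (1 : ℝ) / (2 * (n + 1 : ℕ)) < δ := by
    refine lt_of_le_of_lt ?_ hn
    push_cast
    gcongr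
    linarith
  obtain ⟨F, G, h₁, h₂, h₃, -⟩ := H (n + 1) _ hh hN hhδ f g ⟨hf.continuousOn, hg, hgf⟩
    fun y _ => hfO y
  have hsub : Icc (0 : ι → ℝ) 1 ⊆ gridSkeleton ι (1 / (2 * (n + 1 : ℕ))) (n + 1)
      (Fintype.card ι + 1) ∪ Z := (Icc_subset_gridSkeleton hh hN).trans subset_union_left
  exact ⟨F, G, ⟨h₁.continuousOn.mono hsub, h₁.continuousOn_lift.mono (inter_subset_inter_left T hsub),
    fun y hy => h₁.comp_eq y ⟨hsub hy.1, hy.2⟩⟩, h₂, h₃⟩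

end Extension

/-! ### Homotopy groups -/

section CubeCoordinates

variable {n : ℕ}

/-- The retraction of `ℝ^{n+1}` to the unit cube, followed by the projection to the last `n`
coordinates. -/
noncomputable def cubeTail (y : Fin (n + 1) → ℝ) : Fin n → unitInterval := fun i => projIcc 0 1 zero_le_one (y i.succ)

/-- The point of `ℝ^{n+1}` with first coordinate `t` and other coordinates `x`. -/
def cubeCons (p : unitInterval × (Fin n → unitInterval)) : Fin (n + 1) → ℝ := Fin.cons (p.1 : ℝ) fun i => (p.2 i : ℝ)

/-- The facets `y 0 = ε` for a vertex `ε` of the interval. -/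
def endFacet (n : ℕ) (ε : ℕ) : Set (Fin (n + 1) → ℝ) := {y | y 0 = ε}

/-- The union of the facets on which one of the last `n` coordinates is `0` or `1`. -/
def sideFacets (n : ℕ) : Set (Fin (n + 1) → ℝ) :=
  ⋃ i : Fin n, {y | y i.succ = (0 : ℕ)} ∪ {y | y i.succ = (1 : ℕ)}

theorem continuous_cubeTail : Continuous (cubeTail (n := n)) :=
  continuous_pi fun i => continuous_projIcc.comp (continuous_apply i.succ)

theorem continuous_cubeCons : Continuous (cubeCons (n := n)) := by
  refine continuous_pi fun i => ?_
  refine Fin.cases ?_ (fun i => ?_) i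
  · exact continuous_subtype_val.comp continuous_fst
  · exact continuous_subtype_val.comp ((continuous_apply i).comp continuous_snd)

theorem cubeTail_cubeCons (p : unitInterval × (Fin n → unitInterval)) : cubeTail (cubeCons p) = p.2 := by
  funext i
  simp [cubeTail, cubeCons]

theorem cubeCons_mem_Icc (p : unitInterval × (Fin n → unitInterval)) : cubeCons p ∈ Icc (0 : Fin (n + 1) → ℝ) 1 := by
  refine ⟨fun i => ?_, fun i => ?_⟩ <;> refine Fin.cases ?_ (fun i => ?_) i
  exacts [p.1.2.1, (p.2 i).2.1, p.1.2.2, (p.2 i).2.2]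

theorem cubeCons_mem_sideFacets {p : unitInterval × (Fin n → unitInterval)} (hp : p.2 ∈ Cube.boundary (Fin n)) :
    cubeCons p ∈ sideFacets n := by
  obtain ⟨i, hi⟩ := hp
  refine mem_iUnion.2 ⟨i, hi.imp (fun h => ?_) fun h => ?_⟩ <;> simp [cubeCons, h]

theorem cubeTail_mem_boundary {y : Fin (n + 1) → ℝ} (hy : y ∈ sideFacets n) :
    cubeTail y ∈ Cube.boundary (Fin n) := by
  obtain ⟨i, hi⟩ := mem_iUnion.1 hy
  refine ⟨i, hi.imp (fun h => ?_) fun h => ?_⟩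
  · rw [cubeTail, show y i.succ = 0 by simpa using h, projIcc_left]; rfl
  · rw [cubeTail, show y i.succ = 1 by simpa using h, projIcc_right]; rfl

theorem isClosed_endFacet (n ε : ℕ) : IsClosed (endFacet n ε) :=
  isClosed_eq (continuous_apply 0) continuous_const

theorem isClosed_sideFacets (n : ℕ) : IsClosed (sideFacets n) :=
  isClosed_iUnion_of_finite fun i =>
    (isClosed_eq (continuous_apply i.succ) continuous_const).union
      (isClosed_eq (continuous_apply i.succ) continuous_const)

theorem isCellular_endFacet (n ε : ℕ) : IsCellular (endFacet n ε) := isCellular_facet 0 ε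

theorem isCellular_sideFacets (n : ℕ) : IsCellular (sideFacets n) :=
  IsCellular.iUnion fun i => (isCellular_facet i.succ 0).union (isCellular_facet i.succ 1)

end CubeCoordinates

/-! ### From local filling of spheres to weak homotopy equivalence -/

section WeakEquivalence

variable {M P : Type*} [TopologicalSpace M] [TopologicalSpace P] (σ : C(P, M))

/-- The extension theorem is applied to the constant homotopy of `γ`, kept fixed on the bottom and
the sides and lifted on the top. The altered map is itself the homotopy from `γ` to the image of a
loop in `P`. -/
theorem piMap_surjective (n : ℕ)
    (hloc : ∀ (q : M) (N : Set M), IsOpen N → q ∈ N → ∃ W : Set M, IsOpen W ∧ q ∈ W ∧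
      ConeExtends (Fin (n + 1)) W N ∧ ConeExtends (Fin (n + 1)) (σ ⁻¹' W) (σ ⁻¹' N)) (x : P) :
    Function.Surjective (piMap n σ x) := by
  intro γ
  induction γ using Quotient.inductionOn with | h γ => ?_
  obtain ⟨F, G, hFG, hF, hG⟩ := exists_cube_extension (T := endFacet n 1)
    (Z := endFacet n 0 ∪ sideFacets n) σ.continuous hloc
    (isClosed_endFacet n 1) (isCellular_endFacet n 1)
    ((isClosed_endFacet n 0).union (isClosed_sideFacets n))
    ((isCellular_endFacet n 0).union (isCellular_sideFacets n))
    (γ.1.continuous.comp continuous_cubeTail) (g := fun _ => x) continuousOn_const (by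
      rintro y ⟨hy | hy, hy'⟩
      · exact absurd ((show y 0 = _ from hy).symm.trans hy') (by norm_num)
      · exact (γ.2 _ (cubeTail_mem_boundary hy)).symm)
  have hmemT : ∀ z : Fin n → unitInterval, cubeCons (1, z) ∈ Icc 0 1 ∩ endFacet n 1 := fun z =>
    ⟨cubeCons_mem_Icc _, by simp [endFacet, cubeCons]⟩
  have hGc : Continuous fun z : Fin n → unitInterval => G (cubeCons (1, z)) :=
    hFG.continuousOn_lift.comp_continuous
      (continuous_cubeCons.comp (by fun_prop : Continuous fun z : Fin n → unitInterval => ((1 : unitInterval), z))) hmemT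
  have hFc : Continuous fun p : unitInterval × (Fin n → unitInterval) => F (cubeCons p) :=
    hFG.continuousOn.comp_continuous continuous_cubeCons cubeCons_mem_Icc
  have hFside : ∀ (t : unitInterval) (z : Fin n → unitInterval), z ∈ Cube.boundary (Fin n) → F (cubeCons (t, z)) = γ z := by
    intro t z hz
    rw [hF _ (Or.inr (cubeCons_mem_sideFacets hz)), Function.comp_apply, cubeTail_cubeCons]
    rfl
  refine ⟨Quotient.mk _ ⟨⟨_, hGc⟩, fun z hz =>
    hG _ ⟨Or.inr (cubeCons_mem_sideFacets hz), (hmemT z).2⟩⟩, Quotient.sound ?_⟩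
  refine GenLoop.Homotopic.symm ⟨⟨⟨⟨_, hFc⟩, fun z => ?_, fun z => ?_⟩, fun t z hz => hFside t z hz⟩⟩
  · show F (cubeCons (0, z)) = γ z
    rw [hF _ (Or.inl (by simp [endFacet, cubeCons])), Function.comp_apply, cubeTail_cubeCons]
    rfl
  · exact (hFG.comp_eq _ (hmemT z)).symm

/-- Here `T` is everything and `Z` consists of all facets: a homotopy in `M` is replaced by one that
lifts to `P`, with the given lift on the boundary of the cube. -/
theorem piMap_injective (n : ℕ)
    (hloc : ∀ (q : M) (N : Set M), IsOpen N → q ∈ N → ∃ W : Set M, IsOpen W ∧ q ∈ W ∧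
      ConeExtends (Fin (n + 1)) W N ∧ ConeExtends (Fin (n + 1)) (σ ⁻¹' W) (σ ⁻¹' N)) (x : P) :
    Function.Injective (piMap n σ x) := by
  intro γ₀ γ₁ hγ
  induction γ₀ using Quotient.inductionOn with | h γ₀ => ?_
  induction γ₁ using Quotient.inductionOn with | h γ₁ => ?_
  obtain ⟨H⟩ : GenLoop.Homotopic (genLoopPush (Fin n) σ x γ₀) (genLoopPush (Fin n) σ x γ₁) :=
    Quotient.exact hγ
  have hγ₀ : ∀ y ∈ sideFacets n, γ₀ (cubeTail y) = x := fun y hy =>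
    γ₀.2 _ (cubeTail_mem_boundary hy)
  have hγ₁ : ∀ y ∈ sideFacets n, γ₁ (cubeTail y) = x := fun y hy =>
    γ₁.2 _ (cubeTail_mem_boundary hy)
  classical
  -- On the sides all three branches equal `x`, so the pieces agree on overlaps.
  let g : (Fin (n + 1) → ℝ) → P := fun y =>
    if y 0 = 0 then γ₀ (cubeTail y) else if y 0 = 1 then γ₁ (cubeTail y) else x
  have hg0 : ∀ y ∈ endFacet n 0, g y = γ₀ (cubeTail y) := fun y hy => if_pos (by simpa [endFacet] using hy)
  have hg1 : ∀ y ∈ endFacet n 1, g y = γ₁ (cubeTail y) := fun y hy => by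
    have : y 0 = 1 := by simpa [endFacet] using hy
    simp [g, this]
  have hgs : ∀ y ∈ sideFacets n, g y = x := fun y hy => by
    simp only [g, hγ₀ y hy, hγ₁ y hy, ite_self]
  have hgc : ContinuousOn g (endFacet n 0 ∪ endFacet n 1 ∪ sideFacets n) := by
    refine ContinuousOn.union_of_isClosed (ContinuousOn.union_of_isClosed ?_ ?_
      (isClosed_endFacet n 0) (isClosed_endFacet n 1)) (continuousOn_const.congr hgs)
      ((isClosed_endFacet n 0).union (isClosed_endFacet n 1)) (isClosed_sideFacets n)
    · exact (γ₀.1.continuous.comp continuous_cubeTail).continuousOn.congr hg0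
    · exact (γ₁.1.continuous.comp continuous_cubeTail).continuousOn.congr hg1
  -- The projections onto the cube extend the homotopy to all of `ℝ^{n+1}`, as the extension theorem
  -- requires.
  have hf : Continuous fun y : Fin (n + 1) → ℝ => H (projIcc 0 1 zero_le_one (y 0), cubeTail y) :=
    H.continuous.comp ((continuous_projIcc.comp (continuous_apply 0)).prodMk continuous_cubeTail)
  obtain ⟨F, G, hFG, hF, hG⟩ := exists_cube_extension (T := univ)
    (Z := endFacet n 0 ∪ endFacet n 1 ∪ sideFacets n) σ.continuous hloc isClosed_univ isCellular_univ
    (((isClosed_endFacet n 0).union (isClosed_endFacet n 1)).union (isClosed_sideFacets n))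
    (((isCellular_endFacet n 0).union (isCellular_endFacet n 1)).union (isCellular_sideFacets n))
    hf (g := g) (hgc.mono inter_subset_left) (by
      rintro y ⟨(hy | hy) | hy, -⟩
      · rw [hg0 y hy, show y 0 = 0 by simpa [endFacet] using hy, projIcc_left]
        exact (H.map_zero_left (cubeTail y)).symm
      · rw [hg1 y hy, show y 0 = 1 by simpa [endFacet] using hy, projIcc_right]
        exact (H.map_one_left (cubeTail y)).symm
      · rw [hgs y hy, H.eq_fst _ (cubeTail_mem_boundary hy)]
        exact congrArg σ (hγ₀ y hy).symm)
  have hGc : Continuous fun p : unitInterval × (Fin n → unitInterval) => G (cubeCons p) :=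
    hFG.continuousOn_lift.comp_continuous continuous_cubeCons
      fun p => ⟨cubeCons_mem_Icc p, mem_univ _⟩
  refine Quotient.sound ⟨⟨⟨⟨_, hGc⟩, fun z => ?_, fun z => ?_⟩, fun t z hz => ?_⟩⟩
  · have hz : cubeCons (0, z) ∈ endFacet n 0 := by simp [endFacet, cubeCons]
    show G (cubeCons (0, z)) = γ₀ z
    rw [hG _ ⟨Or.inl (Or.inl hz), mem_univ _⟩, hg0 _ hz, cubeTail_cubeCons]
  · have hz : cubeCons (1, z) ∈ endFacet n 1 := by simp [endFacet, cubeCons]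
    show G (cubeCons (1, z)) = γ₁ z
    rw [hG _ ⟨Or.inl (Or.inr hz), mem_univ _⟩, hg1 _ hz, cubeTail_cubeCons]
  · have hz' := cubeCons_mem_sideFacets (p := (t, z)) hz
    show G (cubeCons (t, z)) = γ₀ z
    rw [hG _ ⟨Or.inr hz', mem_univ _⟩, hgs _ hz']
    exact (γ₀.2 z hz).symm

/-- Generalized loops of dimension `0` are points. -/
def pointLoop {X : Type*} [TopologicalSpace X] (x y : X) : GenLoop (Fin 0) X x :=
  ⟨ContinuousMap.const _ y, fun _ ⟨i, _⟩ => i.elim0⟩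

theorem joined_of_homotopic {X : Type*} [TopologicalSpace X] {x : X} {γ₀ γ₁ : GenLoop (Fin 0) X x}
    (h : GenLoop.Homotopic γ₀ γ₁) (z : Fin 0 → unitInterval) : Joined (γ₀ z) (γ₁ z) :=
  h.map fun H => H.toHomotopy.evalAt z

theorem homotopic_pointLoop {X : Type*} [TopologicalSpace X] (x : X) {y y' : X} (h : Joined y y') :
    GenLoop.Homotopic (pointLoop x y) (pointLoop x y') := by
  obtain ⟨p⟩ := h
  exact ⟨⟨⟨p.toContinuousMap.comp ⟨Prod.fst, continuous_fst⟩, fun _ => p.source, fun _ => p.target⟩,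
    fun _ _ ⟨i, _⟩ => i.elim0⟩⟩

/-- Loops of dimension `0` are arbitrary points and their homotopies are paths, so `π_0` at any base
point already records all path components. Only the existence of a base point is needed in addition.
-/
theorem piZeroMap_bijective (hP : Nonempty M → Nonempty P)
    (hbij : ∀ x : P, Function.Bijective (piMap 0 σ x)) : Function.Bijective (piZeroMap σ) := by
  constructor
  · intro a b hab
    induction a using Quotient.inductionOn with | h a => ?_
    induction b using Quotient.inductionOn with | h b => ?_
    have hj : Joined (σ a) (σ b) := Quotient.exact hab
    have h : piMap 0 σ a (Quotient.mk _ (pointLoop a a)) =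
        piMap 0 σ a (Quotient.mk _ (pointLoop a b)) :=
      Quotient.sound (homotopic_pointLoop (σ a) hj)
    exact Quotient.sound (joined_of_homotopic (Quotient.exact ((hbij a).1 h)) Fin.elim0)
  · intro q
    induction q using Quotient.inductionOn with | h q => ?_
    obtain ⟨x⟩ := hP ⟨q⟩
    obtain ⟨γ, hγ⟩ := (hbij x).2 (Quotient.mk _ (pointLoop (σ x) q))
    induction γ using Quotient.inductionOn with | h γ => ?_
    exact ⟨Quotient.mk _ (γ Fin.elim0),
      Quotient.sound (joined_of_homotopic (Quotient.exact hγ) Fin.elim0)⟩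

/-- A map along which spheres can be filled locally is a weak homotopy equivalence. -/
theorem isWeakHomotopyEquivalence_of_coneExtends (hP : Nonempty M → Nonempty P)
    (hloc : ∀ (n : ℕ) (q : M) (N : Set M), IsOpen N → q ∈ N → ∃ W : Set M, IsOpen W ∧ q ∈ W ∧
      ConeExtends (Fin (n + 1)) W N ∧ ConeExtends (Fin (n + 1)) (σ ⁻¹' W) (σ ⁻¹' N)) :
    IsWeakHomotopyEquivalence σ := by
  have hbij : ∀ (n : ℕ) (x : P), Function.Bijective (piMap n σ x) := fun n x =>
    ⟨piMap_injective σ n (hloc n) x, piMap_surjective σ n (hloc n) x⟩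
  exact ⟨piZeroMap_bijective σ hP (hbij 0), hbij⟩

end WeakEquivalence

theorem mainTheorem6 {M : Type u} [TopologicalSpace M] [T2Space M]
    {A : Type v} [Preorder A] [IsDirectedOrder A] [Nonempty A]
    (S : A →o Set M) [∀ α, TopologicalSpace (Step S α)]
    (hdense : Dense (⋃ α, S α))
    (hincl : ∀ α, Continuous (stepIncl S α))
    (htrans : ∀ (α β : A) (h : α ≤ β), Continuous (stepTrans S h))
    (hcharts : AdmitsWellFilledCharts.{u, v, w, w'} S)
    [TopologicalSpace (UnionSpace S)]
    (hstepToUnion : ∀ α, Continuous (stepToUnion S α))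
    (hunionIncl : Continuous (unionIncl S))
    (hretractive : CompactlyRetractive S) :
    IsWeakHomotopyEquivalence (⟨unionIncl S, hunionIncl⟩ : C(UnionSpace S, M)) := by
  refine isWeakHomotopyEquivalence_of_coneExtends _ (fun h => ?_) fun n q N hN hq =>
    exists_coneExtends_nhd S hdense htrans hcharts hstepToUnion hretractive _ q N hN hq
  obtain ⟨x, hx⟩ := hdense.nonempty
  exact ⟨⟨x, hx⟩⟩
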